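/- **Setting.** Fix $N,n\ge 0$ and $r_1,\dots,r_n,r_\infty\ge 0$. Let $({\bf t},{\bf D})$ range over an open set $\mathfrak P$ of a finite-dimensional real vector space $\mathfrak T\times\mathfrak D$, and let $$B(\zeta)=\sum_{\nu=1}^n\sum_{k=0}^{r_\nu}\frac{B_{\nu,-k}}{(\zeta-b^{(\nu)})^{k+1}}-\sum_{k=1}^{r_\infty}B_{\infty,-k}\,\zeta^{k-1}$$ be an $N\times N$ matrix depending on $({\bf t},{\bf D})$. Put $F(\zeta,\mu)=\det(B(\zeta)-\mu I)$ and let $\Gamma_{({\bf t},{\bf D})}=\{(\zeta,\mu): \zeta\ne b^{(\nu)}\ \forall\nu,\ F(\zeta,\mu)=0\}$ be the spectral curve punctured over $b^{(1)},\dots,b^{(n)},\infty$. The branches of $\mu$ are $\mu_i=\sum_{k=0}^{r_\nu}(t^{(\nu)}_{-k})_{ii}(\zeta-b^{(\nu)})^{-k-1}+O(1)$ as $\zeta\to b^{(\nu)}$, and $\mu_i=-\sum_{k=1}^{r_\infty}(t^{(\infty)}_{-k})_{ii}\zeta^{k-1}-(t^{(\infty)}_0)_{ii}\zeta^{-1}+O(\zeta^{-2})$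 as $\zeta\to\infty$. The $b^{(\nu)}$ and $t^{(\nu)}_{-k}$ are continuous in the parameters; $b^{(\nu)}$, $t^{(\nu)}_{-k}$ $(k\ne0)$ and $\mathrm{Re}\,t_0^{(\nu)}$ depend on ${\bf t}$ only, and $\mathrm{Im}\,t_0^{(\nu)}$ on ${\bf D}$ only. Let $\mathfrak F$ (fixed singularities) be the union of the sets $b^{(\nu)}=b^{(\rho)}$ $(\nu\ne\rho)$, $(t^{(\nu)}_{-r_\nu})_{ii}=(t^{(\nu)}_{-r_\nu})_{jj}$ $(i\neq j)$ and $(t^{(\nu)}_{-r_\nu})_{kk}=0$ $(\nu=1,\dots,n,\infty)$. Outside $\mathfrak F$, $F$ is continuously differentiable jointly in $({\bf t},{\bf D},\zeta,\mu)$ for $\zeta\neq b^{(\nu)}$. The asymptotics of the $\mu_i$ are likewise required only outside $\mathfrak F$. Let $\mathfrak S$ (discriminant set) be the set of parameters for which $\Gamma$ has a singular point, i.e. a point with $F=\partial_\zeta F=\partial_\mu F=0$. Closed paths are piecewise $C^1$, and $J_\ell=\mathrm{Re}\oint_\ell\mu\,d\zeta$. A *continuous family* of closed paths over $W\subseteq\mathfrak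 P\setminus\mathfrak F$ consists of closed paths $\ell_p:[0,1]\to\Gamma_p$, $p\in W$, with $\ell_p(s)$ jointly continuous in $(p,s)\in W\times[0,1]$. **Proposition.** 1. (Continuity outside $\mathfrak F$.) Let $(\ell_p)_{p\in W}$ be a continuous family of closed paths over any set $W\subseteq\mathfrak P\setminus\mathfrak F$ (which may meet $\mathfrak S$), such that, near each $p\in W$ for which $\ell_p$ passes through a singular point of $\Gamma_p$, the lengths of the projections of the $\ell_{p'}$, $p'\in W$, to the $\zeta$-plane are bounded. Then $p\mapsto J_{\ell_p}$ is continuous on $W$. 2. (Differentiability outside $\mathfrak S$.) For every continuous family of closed paths over a set $W\subseteq\mathfrak P\setminus\mathfrak F$, the function $p\mapsto J_{\ell_p}$ is (real) differentiable within $W$ at each $p\in W\setminus\mathfrak S$, and also at each $p\in W\cap\mathfrak S$ for which $\ell_p$ avoids the singular points of $\Gamma_p$. 3. (A single path.) Let $p_0\in\mathfrak P\setminus\mathfrak F$ and let $\ell$ be a closed path on $\Gamma_{p_0}$; if $p_0\in\mathfrak S$, assume that $\ell$ avoids the singular points of $\Gamma_{p_0}$. Then for every $\varepsilon_0>0$ there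 are $0<\varepsilon<\varepsilon_0$, an open neighbourhood $V\subseteq\mathfrak P\setminus\mathfrak F$ of $p_0$ and a differentiable function $J_\ell:V\to\mathbb R$ such that for every $p\in V$ there is a closed path on $\Gamma_p$ that is uniformly $\varepsilon$-close to $\ell$, and every such path $\ell'$ satisfies $\mathrm{Re}\oint_{\ell'}\mu\,d\zeta=J_\ell(p)$. -/

import Mathlib

open scoped Topology unitInterval

noncomputable section

/-- The data of an `N × N` rational coefficient matrix at `δ = 0`,
`B(ζ) = ∑_ν ∑_{k=0}^{r_ν} B_{ν,-k} / (ζ - b^{(ν)})^{k+1} - ∑_{k=1}^{r_∞} B_{∞,-k} ζ^{k-1}`,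
as a function of the parameters `(𝐭, 𝐃) ∈ T × D`.  Singularities are labelled by `Option (Fin n)`;
`some ν` is the finite singularity `b^{(ν)}` and `none` is infinity.

* `dom` is the total parameter space `𝔓`;
* `b ν` is the position of the `ν`-th finite singularity;
* `t ν k i` is the `i`-th diagonal entry of `t_{-k}^{(ν)}` (used for `k ≤ r_ν`);
* `B ν k` is the matrix `B_{ν,-k}` (used for `k ≤ r_ν`; for `ν = ∞` only with `1 ≤ k`). -/
structure SpectralData (N n : ℕ) (r : Option (Fin n) → ℕ) (T D : Type*) where
  dom : Set (T × D)
  b : Fin n → T × D → ℂ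
  t : Option (Fin n) → ℕ → Fin N → T × D → ℂ
  B : Option (Fin n) → ℕ → T × D → Matrix (Fin N) (Fin N) ℂ

namespace SpectralData

variable {N n : ℕ} {r : Option (Fin n) → ℕ} {T D : Type*}

/-- The matrix `B(ζ)` at the parameter value `p = (𝐭, 𝐃)`. -/
def coeffMatrix (S : SpectralData N n r T D) (p : T × D) (ζ : ℂ) : Matrix (Fin N) (Fin N) ℂ :=
  ∑ ν : Fin n, ∑ k ∈ Finset.range (r (some ν) + 1),
      ((ζ - S.b ν p) ^ (k + 1))⁻¹ • S.B (some ν) k p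
    - ∑ k ∈ Finset.Icc 1 (r none), ζ ^ (k - 1) • S.B none k p

/-- `F(ζ, μ) = det (B(ζ) - μ I)`. -/
def F (S : SpectralData N n r T D) (p : T × D) (ζ μ : ℂ) : ℂ :=
  (S.coeffMatrix p ζ - μ • (1 : Matrix (Fin N) (Fin N) ℂ)).det

/-- The spectral curve `Γ_as` punctured over the points `b^{(ν)}`, `ν = 1, …, n, ∞`:
the pairs `(ζ, μ)` with `F(ζ, μ) = 0` and `ζ` finite and different from all `b^{(ν)}`. -/
def curve (S : SpectralData N n r T D) (p : T × D) : Set (ℂ × ℂ) :=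
  {x | (∀ ν, x.1 ≠ S.b ν p) ∧ S.F p x.1 x.2 = 0}

/-- The singular points of the punctured curve: `F = ∂F/∂ζ = ∂F/∂μ = 0`. -/
def singularPoints (S : SpectralData N n r T D) (p : T × D) : Set (ℂ × ℂ) :=
  {x | x ∈ S.curve p ∧ deriv (fun ζ => S.F p ζ x.2) x.1 = 0 ∧
    deriv (fun μ => S.F p x.1 μ) x.2 = 0}

/-- The fixed singularities `𝔉`: the union of `b^{(ν)} = b^{(ρ)}` (`ν ≠ ρ`),
`(t_{-r_ν}^{(ν)})_{ii} = (t_{-r_ν}^{(ν)})_{jj}` (`i ≠ j`) and `(t_{-r_ν}^{(ν)})_{kk} = 0`. -/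
def fixedSing (S : SpectralData N n r T D) : Set (T × D) :=
  {p | (∃ ν ρ, ν ≠ ρ ∧ S.b ν p = S.b ρ p) ∨
    (∃ ν i j, i ≠ j ∧ S.t ν (r ν) i p = S.t ν (r ν) j p) ∨
    (∃ ν k, S.t ν (r ν) k p = 0)}

/-- The discriminant set `𝔖`: the parameter values at which the spectral curve is singular. -/
def discrSet (S : SpectralData N n r T D) : Set (T × D) :=
  {p | p ∈ S.dom ∧ (S.singularPoints p).Nonempty}

/-- `S` is a parameterization of the spectral curve by the deformation parameters `𝐭` and the
remaining parameters `𝐃`. -/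
structure IsParameterization [NormedAddCommGroup T] [NormedSpace ℝ T]
    [NormedAddCommGroup D] [NormedSpace ℝ D] (S : SpectralData N n r T D) : Prop where
  isOpen_dom : IsOpen S.dom
  continuousOn_b : ∀ ν, ContinuousOn (S.b ν) S.dom
  continuousOn_t : ∀ ν k i, k ≤ r ν → ContinuousOn (S.t ν k i) S.dom
  /-- The positions `b^{(ν)}`, the entries of `t_{-k}^{(ν)}` with `k ≠ 0`, and `Re t_0^{(ν)}` are
  functions of `𝐭` only, while `Im t_0^{(ν)}` is a function of `𝐃` only. -/
  b_eq : ∀ p ∈ S.dom, ∀ p' ∈ S.dom, p.1 = p'.1 → ∀ ν, S.b ν p = S.b ν p'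
  t_eq : ∀ p ∈ S.dom, ∀ p' ∈ S.dom, p.1 = p'.1 → ∀ ν i, ∀ k ∈ Finset.Icc 1 (r ν),
    S.t ν k i p = S.t ν k i p'
  re_t_zero_eq : ∀ p ∈ S.dom, ∀ p' ∈ S.dom, p.1 = p'.1 → ∀ ν i,
    (S.t ν 0 i p).re = (S.t ν 0 i p').re
  im_t_zero_eq : ∀ p ∈ S.dom, ∀ p' ∈ S.dom, p.2 = p'.2 → ∀ ν i,
    (S.t ν 0 i p).im = (S.t ν 0 i p').im
  /-- The curve depends in a continuously differentiable way on the parameters. -/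
  contDiffOn_F : ContDiffOn ℝ 1 (fun q : (T × D) × ℂ × ℂ => S.F q.1 q.2.1 q.2.2)
    {q | q.1 ∈ S.dom \ S.fixedSing ∧ ∀ ν, q.2.1 ≠ S.b ν q.1}
  /-- The `t_{-k}^{(ν)}` give the singular part of the branches of `μ dζ` over `b^{(ν)}`:
  `μ_i(ζ) = ∑_{k=0}^{r_ν} (t_{-k}^{(ν)})_{ii} (ζ - b^{(ν)})^{-k-1} + O(1)`. -/
  singular_part : ∀ p ∈ S.dom \ S.fixedSing, ∀ ν : Fin n, ∃ m : Fin N → ℂ → ℂ,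
    (∀ᶠ ζ in 𝓝[≠] (S.b ν p), (S.coeffMatrix p ζ).charpoly =
      ∏ i, (Polynomial.X - Polynomial.C (m i ζ))) ∧
    ∀ i, (fun ζ => m i ζ - ∑ k ∈ Finset.range (r (some ν) + 1),
      S.t (some ν) k i p / (ζ - S.b ν p) ^ (k + 1)) =O[𝓝[≠] (S.b ν p)] (fun _ => (1 : ℂ))
  /-- The same at infinity:
  `μ_i(ζ) = -∑_{k=1}^{r_∞} (t_{-k}^{(∞)})_{ii} ζ^{k-1} - (t_0^{(∞)})_{ii} ζ^{-1} + O(ζ^{-2})`. -/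
  singular_part_infty : ∀ p ∈ S.dom \ S.fixedSing, ∃ m : Fin N → ℂ → ℂ,
    (∀ᶠ ζ in Bornology.cobounded ℂ, (S.coeffMatrix p ζ).charpoly =
      ∏ i, (Polynomial.X - Polynomial.C (m i ζ))) ∧
    ∀ i, (fun ζ => m i ζ + ∑ k ∈ Finset.Icc 1 (r none), S.t none k i p * ζ ^ (k - 1)
      + S.t none 0 i p / ζ) =O[Bornology.cobounded ℂ] (fun ζ => (ζ ^ 2)⁻¹)

end SpectralData

/-- Piecewise continuously differentiable paths in `ℂ × ℂ`. -/
def IsPiecewiseC1 {x y : ℂ × ℂ} (γ : Path x y) : Prop :=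
  ∃ (m : ℕ) (s : ℕ → ℝ), Monotone s ∧ s 0 = 0 ∧ s m = 1 ∧
    ∀ i < m, ContDiffOn ℝ 1 γ.extend (Set.Icc (s i) (s (i + 1)))

/-- The 1-form `μ dζ` on `ℂ × ℂ`. -/
def muForm (x : ℂ × ℂ) : ℂ × ℂ →L[ℂ] ℂ := x.2 • ContinuousLinearMap.fst ℂ ℂ ℂ

/-- `J_ℓ = Re ∮_ℓ μ dζ`. -/
def periodJ {x : ℂ × ℂ} (ℓ : Path x x) : ℝ := (curveIntegral muForm ℓ).re

/-- The length `∫ |dζ|` of the projection of a path to the `ζ`-plane. -/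
def projLength {x y : ℂ × ℂ} (γ : Path x y) : ℝ :=
  ∫ s in (0 : ℝ)..1, ‖derivWithin (fun s => (γ.extend s).1) (Set.Icc 0 1) s‖

namespace SpectralData

variable {N n : ℕ} {r : Option (Fin n) → ℕ} {T D : Type*}

/-- `ℓ` is a (piecewise smooth) closed path on the punctured curve at the parameter value `p`. -/
def IsClosedPathOn (S : SpectralData N n r T D) (p : T × D) {x : ℂ × ℂ} (ℓ : Path x x) : Prop :=
  IsPiecewiseC1 ℓ ∧ ∀ s, ℓ s ∈ S.curve p

/-- `ℓ` is a closed path carried along by the curves with `p ∈ W`: each `ℓ p` is a closed path on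
the punctured curve at `p`, and `ℓ p s` is jointly continuous in `p` and `s`. -/
def IsClosedPathFamily [TopologicalSpace T] [TopologicalSpace D] (S : SpectralData N n r T D)
    (W : Set (T × D)) {x : T × D → ℂ × ℂ} (ℓ : ∀ p, Path (x p) (x p)) : Prop :=
  (∀ p ∈ W, S.IsClosedPathOn p (ℓ p)) ∧
    ContinuousOn (fun q : (T × D) × I => ℓ q.1 q.2) (W ×ˢ Set.univ)

end SpectralData

end

/-!
Near a smooth point a spectral curve is, by the implicit function theorem, the graph of a function
holomorphic in `ζ` and differentiable in the parameters, or the same with `ζ` and `μ` exchanged,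
where `μ dζ = d(ζμ) - ζ dμ`.  Hence `μ dζ` has local primitives that depend differentiably on the
parameters, and on overlaps two of them differ by a function of the parameters alone.  Continuing a
primitive along a closed path, one arrives at a second primitive near the base point, and the period
is the difference of the two: a differentiable function of the parameters that takes the same value
on all nearby paths.  Nearby closed paths on the nearby curves are obtained by following the local
graphs.

No primitive is available where the path meets a singular point.  There integration by parts gives
`∮ μ' dζ' - ∮ μ dζ = ∮ (μ' - μ) dζ' - ∮ (ζ' - ζ) dμ`, which for `ε`-close paths is at most `ε` times
the sum of the length of the projection of the nearby path and the variation of `μ` along the given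
one.
-/

section

open MeasureTheory Set Metric Filter

/-! ## Piecewise `C¹` paths and their periods -/

section PiecewiseC1

variable {F G : Type*} [NormedAddCommGroup F] [NormedSpace ℝ F] [NormedAddCommGroup G]
  [NormedSpace ℝ G]

theorem deriv_fst_comp {f : ℝ → F × G} {t : ℝ} (hf : DifferentiableAt ℝ f t) :
    deriv (fun s => (f s).1) t = (deriv f t).1 :=
  ((ContinuousLinearMap.fst ℝ F G).hasFDerivAt.comp_hasDerivAt t hf.hasDerivAt).deriv

/-- Piecewise continuously differentiable curves on `[a, b]`: `f` is `C¹` on each of the closed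
intervals of some subdivision `s 0 ≤ ⋯ ≤ s m`. With this order of the data `IsPiecewiseC1 γ` unfolds
to `PiecewiseC1On γ.extend 0 1`. -/
def PiecewiseC1On (f : ℝ → F) (a b : ℝ) : Prop :=
  ∃ (m : ℕ) (s : ℕ → ℝ), Monotone s ∧ s 0 = a ∧ s m = b ∧
    ∀ i < m, ContDiffOn ℝ 1 f (Icc (s i) (s (i + 1)))

namespace PiecewiseC1On

variable {f g : ℝ → F} {a b c : ℝ}

theorem of_contDiffOn (hab : a ≤ b) (hf : ContDiffOn ℝ 1 f (Icc a b)) :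
    PiecewiseC1On f a b := by
  refine ⟨1, fun i => if i = 0 then a else b, fun i j hij => ?_, by simp, by simp, fun i hi => ?_⟩
  · grind
  · obtain rfl : i = 0 := by omega
    simpa using hf

theorem le (hf : PiecewiseC1On f a b) : a ≤ b := by
  obtain ⟨m, s, hs, rfl, rfl, -⟩ := hf
  exact hs m.zero_le

theorem congr (hf : PiecewiseC1On f a b) (hfg : EqOn g f (Icc a b)) : PiecewiseC1On g a b := by
  obtain ⟨m, s, hs, rfl, rfl, hC⟩ := hf
  exact ⟨m, s, hs, rfl, rfl, fun i hi => (hC i hi).congr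
    (hfg.mono (Icc_subset_Icc (hs i.zero_le) (hs hi)))⟩

theorem trans (hab : PiecewiseC1On f a b) (hbc : PiecewiseC1On f b c) : PiecewiseC1On f a c := by
  obtain ⟨m, s, hs, rfl, rfl, hC⟩ := hab
  obtain ⟨m', s', hs', h0, rfl, hC'⟩ := hbc
  refine ⟨m + m', fun i => if i ≤ m then s i else s' (i - m), monotone_nat_of_le_succ fun i => ?_,
    by simp, ?_, fun i hi => ?_⟩
  · rcases lt_trichotomy i m with h | rfl | h
    · simpa [h.le, Nat.succ_le_of_lt h] using hs i.le_succ
    · simpa [← h0] using hs' zero_le_one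
    · simpa [h.not_ge, (h.trans i.lt_succ_self).not_ge] using hs' (by omega)
  · rcases m'.eq_zero_or_pos with rfl | h
    · simp [h0]
    · simp [h.ne']
  · rcases lt_trichotomy i m with h | rfl | h
    · simpa [h.le, Nat.succ_le_of_lt h] using hC i h
    · simpa [← h0] using hC' 0 (by omega)
    · simpa [h.not_ge, (h.trans i.lt_succ_self).not_ge, Nat.sub_add_comm h.le] using
        hC' (i - m) (by omega)

theorem comp_contDiff (hf : PiecewiseC1On f a b) {L : F → G} (hL : ContDiff ℝ 1 L) :
    PiecewiseC1On (fun t => L (f t)) a b := by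
  obtain ⟨m, s, hs, h0, h1, hC⟩ := hf
  exact ⟨m, s, hs, h0, h1, fun i hi => hL.comp_contDiffOn (hC i hi)⟩

theorem continuousOn (hf : PiecewiseC1On f a b) : ContinuousOn f (Icc a b) := by
  obtain ⟨m, s, hs, rfl, rfl, hC⟩ := hf
  induction m with
  | zero => simp
  | succ m ih =>
    rw [← Icc_union_Icc_eq_Icc (hs m.zero_le) (hs m.le_succ)]
    exact (ih fun i hi => hC i (by omega)).union_of_isClosed (hC m m.lt_succ_self).continuousOn
      isClosed_Icc isClosed_Icc

theorem exists_countable_differentiableAt (hf : PiecewiseC1On f a b) :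
    ∃ Z : Set ℝ, Z.Countable ∧ ∀ t ∈ Ioo a b \ Z, DifferentiableAt ℝ f t := by
  obtain ⟨m, s, -, rfl, rfl, hC⟩ := hf
  refine ⟨range s, countable_range s, fun t ht => ?_⟩
  obtain ⟨i, hi, hit⟩ : ∃ i < m, t ∈ Ioo (s i) (s (i + 1)) := by
    by_contra! h
    have hlt : ∀ i ≤ m, s i < t := fun i => Nat.rec (fun _ => ht.1.1) (fun i ih hi =>
      (not_lt.1 fun hlt => h i hi ⟨ih (by omega), hlt⟩).lt_of_ne fun h => ht.2 ⟨_, h⟩) i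
    exact (hlt m le_rfl).not_gt ht.1.2
  exact ((hC i hi).differentiableOn one_ne_zero t (Ioo_subset_Icc_self hit)).differentiableAt
    (Icc_mem_nhds hit.1 hit.2)

theorem intervalIntegrable_deriv (hf : PiecewiseC1On f a b) :
    IntervalIntegrable (deriv f) volume a b := by
  obtain ⟨m, s, hs, rfl, rfl, hC⟩ := hf
  refine IntervalIntegrable.trans_iterate fun i hi => ?_
  rcases (hs i.le_succ).eq_or_lt with h | h
  · exact h ▸ IntervalIntegrable.refl
  have hcont : ContinuousOn (derivWithin f (Icc (s i) (s (i + 1)))) (uIcc (s i) (s (i + 1))) := by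
    rw [uIcc_of_le h.le]
    exact (hC i hi).continuousOn_derivWithin (uniqueDiffOn_Icc h) le_rfl
  refine hcont.intervalIntegrable.congr_ae ?_
  rw [uIoc_of_le h.le, ← restrict_Ioo_eq_restrict_Ioc]
  filter_upwards [ae_restrict_mem measurableSet_Ioo] with t ht
  exact derivWithin_of_mem_nhds (Icc_mem_nhds ht.1 ht.2)

theorem intervalIntegrable_mul_deriv {u v : ℝ → ℂ} (hv : PiecewiseC1On v a b)
    (hu : ContinuousOn u (Icc a b)) :
    IntervalIntegrable (fun t => u t * deriv v t) volume a b :=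
  hv.intervalIntegrable_deriv.continuousOn_mul (uIcc_of_le hv.le ▸ hu)

theorem integral_mul_deriv_add_deriv_mul {u v : ℝ → ℂ} (hu : PiecewiseC1On u a b)
    (hv : PiecewiseC1On v a b) :
    (∫ t in a..b, u t * deriv v t) + ∫ t in a..b, v t * deriv u t = u b * v b - u a * v a := by
  obtain ⟨Z, hZ, hdu⟩ := hu.exists_countable_differentiableAt
  obtain ⟨Z', hZ', hdv⟩ := hv.exists_countable_differentiableAt
  have hi := hv.intervalIntegrable_mul_deriv hu.continuousOn
  have hi' := hu.intervalIntegrable_mul_deriv hv.continuousOn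
  rw [← intervalIntegral.integral_add hi hi']
  refine integral_eq_of_hasDerivAt_off_countable_of_le (fun t => u t * v t) _ hu.le
    (hZ.union hZ') (hu.continuousOn.mul hv.continuousOn) (fun t ht => ?_) (hi.add hi')
  have htZ : t ∉ Z ∧ t ∉ Z' := not_or.1 ht.2
  refine ((hdu t ⟨ht.1, htZ.1⟩).hasDerivAt.fun_mul (hdv t ⟨ht.1, htZ.2⟩).hasDerivAt).congr_deriv ?_
  ring

theorem integral_snd_mul_deriv_fst {γ : ℝ → ℂ × ℂ} (hγ : PiecewiseC1On γ a b) {Φ : ℂ × ℂ → ℂ}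
    {c d : ℝ} (hac : a ≤ c) (hcd : c ≤ d) (hdb : d ≤ b)
    (hΦ : ∀ t ∈ Icc c d, HasFDerivAt Φ (muForm (γ t)) (γ t)) :
    ∫ t in c..d, (γ t).2 * deriv (fun s => (γ s).1) t = Φ (γ d) - Φ (γ c) := by
  obtain ⟨Z, hZ, hd⟩ := hγ.exists_countable_differentiableAt
  have hcont := hγ.continuousOn.mono (Icc_subset_Icc hac hdb)
  refine integral_eq_of_hasDerivAt_off_countable_of_le (fun t => Φ (γ t)) _ hcd hZ
    (fun t ht => (hΦ t ht).continuousAt.comp_continuousWithinAt (hcont t ht)) (fun t ht => ?_)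
    (((hγ.comp_contDiff contDiff_fst).intervalIntegrable_mul_deriv
      hγ.continuousOn.snd).mono_set ?_)
  · have hγt := (hd t ⟨Ioo_subset_Ioo hac hdb ht.1, ht.2⟩).hasDerivAt
    have h := ((hΦ t (Ioo_subset_Icc_self ht.1)).restrictScalars ℝ).comp_hasDerivAt t hγt
    exact deriv_fst_comp hγt.differentiableAt ▸ h
  · rw [uIcc_of_le hcd, uIcc_of_le hγ.le]
    exact Icc_subset_Icc hac hdb

end PiecewiseC1On

end PiecewiseC1

section Periods

theorem curveIntegral_muForm {x y : ℂ × ℂ} {γ : Path x y} (hγ : IsPiecewiseC1 γ) :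
    curveIntegral muForm γ =
      ∫ t in (0 : ℝ)..1, (γ.extend t).2 * deriv (fun s => (γ.extend s).1) t := by
  obtain ⟨Z, hZ, hd⟩ := PiecewiseC1On.exists_countable_differentiableAt hγ
  rw [curveIntegral_def]
  refine intervalIntegral.integral_congr_ae_restrict ?_
  rw [uIoc_of_le zero_le_one, ← restrict_Ioo_eq_restrict_Ioc]
  filter_upwards [ae_restrict_mem measurableSet_Ioo,
    ae_restrict_of_ae (hZ.ae_notMem volume)] with t ht htZ
  rw [curveIntegralFun_def, derivWithin_of_mem_nhds (Icc_mem_nhds ht.1 ht.2),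
    deriv_fst_comp (hd t ⟨ht, htZ⟩)]
  rfl

theorem projLength_eq_integral_norm_deriv {x y : ℂ × ℂ} (γ : Path x y) :
    projLength γ = ∫ t in (0 : ℝ)..1, ‖deriv (fun s => (γ.extend s).1) t‖ := by
  refine intervalIntegral.integral_congr_ae_restrict ?_
  rw [uIoc_of_le zero_le_one, ← restrict_Ioo_eq_restrict_Ioc]
  filter_upwards [ae_restrict_mem measurableSet_Ioo] with t ht
  rw [derivWithin_of_mem_nhds (Icc_mem_nhds ht.1 ht.2)]

-- Integration by parts moves the derivative of `ζ' - ζ` onto `μ`, so that no bound on the variation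
-- of `μ'` is needed.
theorem curveIntegral_muForm_sub {x y : ℂ × ℂ} {γ : Path x x} {γ' : Path y y}
    (hγ : IsPiecewiseC1 γ) (hγ' : IsPiecewiseC1 γ') :
    curveIntegral muForm γ' - curveIntegral muForm γ =
      (∫ t in (0 : ℝ)..1, (γ'.extend t - γ.extend t).2 * deriv (fun s => (γ'.extend s).1) t) -
        ∫ t in (0 : ℝ)..1, (γ'.extend t - γ.extend t).1 * deriv (fun s => (γ.extend s).2) t := by
  have hζ := PiecewiseC1On.comp_contDiff hγ contDiff_fst
  have hμ := PiecewiseC1On.comp_contDiff hγ contDiff_snd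
  have hζ' := PiecewiseC1On.comp_contDiff hγ' contDiff_fst
  have parts := hμ.integral_mul_deriv_add_deriv_mul hζ
  have parts' := hμ.integral_mul_deriv_add_deriv_mul hζ'
  rw [curveIntegral_muForm hγ, curveIntegral_muForm hγ']
  simp only [Prod.fst_sub, Prod.snd_sub, sub_mul]
  rw [intervalIntegral.integral_sub, intervalIntegral.integral_sub]
  · simp only [Path.extend_zero, Path.extend_one, sub_self] at parts parts'
    linear_combination parts' - parts
  all_goals
    apply PiecewiseC1On.intervalIntegrable_mul_deriv
    · assumption
    · fun_prop

theorem norm_integral_mul_le {u v : ℝ → ℂ} {a b ε : ℝ} (hab : a ≤ b) (hu : ∀ t, ‖u t‖ ≤ ε)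
    (hv : IntervalIntegrable v volume a b) :
    ‖∫ t in a..b, u t * v t‖ ≤ ε * ∫ t in a..b, ‖v t‖ := by
  rw [← intervalIntegral.integral_const_mul]
  refine intervalIntegral.norm_integral_le_of_norm_le hab (Eventually.of_forall fun t _ => ?_)
    (hv.norm.const_mul ε)
  rw [norm_mul]
  gcongr
  exact hu t

theorem abs_periodJ_sub_le {x y : ℂ × ℂ} {γ : Path x x} {γ' : Path y y} (hγ : IsPiecewiseC1 γ)
    (hγ' : IsPiecewiseC1 γ') {ε : ℝ} (hε : ∀ s, dist (γ' s) (γ s) ≤ ε) :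
    |periodJ γ' - periodJ γ| ≤
      ε * (projLength γ' + ∫ t in (0 : ℝ)..1, ‖deriv (fun s => (γ.extend s).2) t‖) := by
  have hε' : ∀ t, ‖γ'.extend t - γ.extend t‖ ≤ ε := fun t => dist_eq_norm (γ'.extend t) _ ▸ hε _
  rw [periodJ, periodJ, ← Complex.sub_re, projLength_eq_integral_norm_deriv, mul_add]
  refine (Complex.abs_re_le_norm _).trans ?_
  rw [curveIntegral_muForm_sub hγ hγ']
  exact (norm_sub_le _ _).trans (add_le_add
    (norm_integral_mul_le zero_le_one (fun t => (norm_snd_le _).trans (hε' t))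
      (PiecewiseC1On.comp_contDiff hγ' contDiff_fst).intervalIntegrable_deriv)
    (norm_integral_mul_le zero_le_one (fun t => (norm_fst_le _).trans (hε' t))
      (PiecewiseC1On.comp_contDiff hγ contDiff_snd).intervalIntegrable_deriv))

end Periods

/-! ## Implicit functions of a complex variable -/

section ImplicitFunction

section Slice

variable {X : Type*} [NormedAddCommGroup X] [NormedSpace ℝ X] {H : X × ℂ → ℂ} {x : X} {b : ℂ}

theorem fderiv_comp_inr_apply (hH : DifferentiableAt ℝ H (x, b))
    (hol : DifferentiableAt ℂ (fun w => H (x, w)) b) (v : ℂ) :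
    (fderiv ℝ H (x, b) ∘L .inr ℝ X ℂ) v = deriv (fun w => H (x, w)) b * v := by
  have h : HasFDerivAt (fun w => H (x, w)) (fderiv ℝ H (x, b) ∘L .inr ℝ X ℂ) b :=
    hH.hasFDerivAt.comp b (hasFDerivAt_prodMk_right x b)
  rw [h.unique (hol.hasDerivAt.hasFDerivAt.restrictScalars ℝ)]
  simp [mul_comm]

theorem eventually_deriv_slice_ne_zero (hH : ContDiffAt ℝ 1 H (x, b))
    (hol : ∀ᶠ q : X × ℂ in 𝓝 (x, b), DifferentiableAt ℂ (fun w => H (q.1, w)) q.2)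
    (hne : deriv (fun w => H (x, w)) b ≠ 0) :
    ∀ᶠ q : X × ℂ in 𝓝 (x, b), deriv (fun w => H (q.1, w)) q.2 ≠ 0 := by
  have hderiv : ∀ᶠ q : X × ℂ in 𝓝 (x, b),
      (fderiv ℝ H q ∘L .inr ℝ X ℂ) 1 = deriv (fun w => H (q.1, w)) q.2 := by
    filter_upwards [hol, hH.eventually (by simp)] with q hq hHq
    rw [fderiv_comp_inr_apply (hHq.differentiableAt one_ne_zero) hq, mul_one]
  have hcont : ContinuousAt (fun q => (fderiv ℝ H q ∘L .inr ℝ X ℂ) 1) (x, b) :=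
    ((hH.continuousAt_fderiv one_ne_zero).clm_comp continuousAt_const).clm_apply continuousAt_const
  filter_upwards [hderiv, hcont.eventually_ne (hderiv.self_of_nhds ▸ hne)] with q hq hqne
  exact hq ▸ hqne

theorem exists_implicit_function_of_deriv_ne_zero [CompleteSpace X] (hH : ContDiffAt ℝ 1 H (x, b))
    (hol : DifferentiableAt ℂ (fun w => H (x, w)) b) (hzero : H (x, b) = 0)
    (hne : deriv (fun w => H (x, w)) b ≠ 0) :
    ∃ g : X → ℂ, ContDiffAt ℝ 1 g x ∧ ∀ᶠ q : X × ℂ in 𝓝 (x, b), H q = 0 ↔ g q.1 = q.2 := by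
  have hinv : (fderiv ℝ H (x, b) ∘L .inr ℝ X ℂ).IsInvertible := by
    refine ⟨(ContinuousLinearEquiv.unitsEquivAut ℂ (Units.mk0 _ hne)).restrictScalars ℝ, ?_⟩
    ext v
    simp [fderiv_comp_inr_apply (hH.differentiableAt one_ne_zero) hol, mul_comm]
  exact ⟨_, hH.contDiffAt_implicitFunction one_ne_zero hinv,
    hzero ▸ hH.eventually_apply_eq_iff_implicitFunction one_ne_zero hinv⟩

end Slice

theorem differentiableAt_complex_of_eventually_eq_zero {K : ℂ × ℂ → ℂ} {h : ℂ → ℂ} {a : ℂ}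
    (hK : DifferentiableAt ℂ K (a, h a)) (hne : deriv (fun w => K (a, w)) (h a) ≠ 0)
    (hh : DifferentiableAt ℝ h a) (hzero : ∀ᶠ z in 𝓝 a, K (z, h z) = 0) :
    DifferentiableAt ℂ h a := by
  set L := fderiv ℂ K (a, h a)
  have hKL : HasFDerivAt K L (a, h a) := hK.hasFDerivAt
  have hL : deriv (fun w => K (a, w)) (h a) = L (0, 1) := by
    have := (hKL.comp (h a) (hasFDerivAt_prodMk_right a (h a))).hasDerivAt.deriv
    simpa [Function.comp_def] using this
  have hker : ∀ u : ℂ, L (u, fderiv ℝ h a u) = 0 := fun u => by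
    have hcomp := (hKL.restrictScalars ℝ).comp a ((hasFDerivAt_id a).prodMk hh.hasFDerivAt)
    have hconst := (hasFDerivAt_const (𝕜 := ℝ) (0 : ℂ) a).congr_of_eventuallyEq hzero
    exact congrArg (fun A : ℂ →L[ℝ] ℂ => A u) (hcomp.unique hconst)
  have hlin : ∀ u v : ℂ, L (u, v) = u * L (1, 0) + v * L (0, 1) := fun u v => by
    rw [← smul_eq_mul, ← smul_eq_mul, ← map_smul, ← map_smul, ← map_add]
    simp
  refine differentiableAt_complex_iff_differentiableAt_real.2
    ⟨hh, mul_right_cancel₀ (hL ▸ hne) ?_⟩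
  have hI := (hlin _ _).symm.trans (hker Complex.I)
  have h1 := (hlin _ _).symm.trans (hker 1)
  rw [smul_eq_mul]
  linear_combination hI - Complex.I * h1

theorem exists_implicit_graph {E : Type*} [NormedAddCommGroup E] [NormedSpace ℝ E] [CompleteSpace E]
    {F : E → ℂ × ℂ → ℂ} {p₀ : E} {a₀ b₀ : ℂ}
    (hF : ContDiffAt ℝ 1 (fun q : E × ℂ × ℂ => F q.1 q.2) (p₀, a₀, b₀))
    (hol : ∀ᶠ q : E × ℂ × ℂ in 𝓝 (p₀, a₀, b₀), DifferentiableAt ℂ (F q.1) q.2)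
    (hzero : F p₀ (a₀, b₀) = 0) (hne : deriv (fun b => F p₀ (a₀, b)) b₀ ≠ 0) :
    ∃ g : E × ℂ → ℂ, ContDiffAt ℝ 1 g (p₀, a₀) ∧
      (∀ᶠ z : E × ℂ in 𝓝 (p₀, a₀), DifferentiableAt ℂ (fun a => g (z.1, a)) z.2) ∧
      ∀ᶠ q : E × ℂ × ℂ in 𝓝 (p₀, a₀, b₀), F q.1 q.2 = 0 ↔ g (q.1, q.2.1) = q.2.2 := by
  set H : (E × ℂ) × ℂ → ℂ := fun q => F q.1.1 (q.1.2, q.2)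
  have hassoc : Continuous fun q : (E × ℂ) × ℂ => (q.1.1, q.1.2, q.2) := by fun_prop
  have hH : ContDiffAt ℝ 1 H ((p₀, a₀), b₀) :=
    hF.comp ((p₀, a₀), b₀) (f := fun q : (E × ℂ) × ℂ => (q.1.1, q.1.2, q.2)) (by fun_prop)
  have hHol : ∀ᶠ q : (E × ℂ) × ℂ in 𝓝 ((p₀, a₀), b₀),
      DifferentiableAt ℂ (F q.1.1) (q.1.2, q.2) :=
    (hassoc.tendsto ((p₀, a₀), b₀)).eventually hol
  have hslice : ∀ᶠ q : (E × ℂ) × ℂ in 𝓝 ((p₀, a₀), b₀),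
      DifferentiableAt ℂ (fun w => H (q.1, w)) q.2 := by
    filter_upwards [hHol] with q hq
    exact hq.comp q.2 (by fun_prop : DifferentiableAt ℂ (fun w => (q.1.2, w)) q.2)
  obtain ⟨g, hg, hiff⟩ :=
    exists_implicit_function_of_deriv_ne_zero hH hslice.self_of_nhds hzero hne
  have hgraph : Tendsto (fun z => (z, g z)) (𝓝 (p₀, a₀)) (𝓝 ((p₀, a₀), b₀)) := by
    simpa [ContinuousAt, hiff.self_of_nhds.1 hzero] using continuousAt_id.prodMk hg.continuousAt
  refine ⟨g, hg, ?_, ?_⟩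
  · filter_upwards [hg.eventually (by simp), hgraph.eventually hHol,
      hgraph.eventually (eventually_deriv_slice_ne_zero hH hslice hne),
      (hgraph.eventually hiff).eventually_nhds] with z hgz hol hne hgz₀
    refine differentiableAt_complex_of_eventually_eq_zero hol hne
      ((hgz.differentiableAt one_ne_zero).comp z.2 (by fun_prop)) ?_
    filter_upwards [(by fun_prop : Continuous fun a => (z.1, a)).continuousAt.eventually hgz₀]
      with a ha
    exact ha.2 rfl
  · exact ((by fun_prop : Continuous fun q : E × ℂ × ℂ => ((q.1, q.2.1), q.2.2)).tendsto
      (p₀, a₀, b₀)).eventually hiff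

end ImplicitFunction

/-! ## Primitives depending on a parameter -/

section ParametricPrimitive

variable {X : Type*} [NormedAddCommGroup X] [NormedSpace ℝ X]

theorem differentiableAt_integral_of_contDiffAt {F : Type*} [NormedAddCommGroup F]
    [NormedSpace ℝ F] {G : X × ℝ → F} {x₀ : X} {a b : ℝ}
    (hG : ∀ t ∈ uIcc a b, ContDiffAt ℝ 1 G (x₀, t)) :
    DifferentiableAt ℝ (fun x => ∫ t in a..b, G (x, t)) x₀ := by
  have hfc : ContinuousOn (fun t => fderiv ℝ G (x₀, t)) (uIcc a b) := fun t ht =>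
    (((hG t ht).continuousAt_fderiv one_ne_zero).comp
      (f := fun t => (x₀, t)) (by fun_prop)).continuousWithinAt
  obtain ⟨C, hC⟩ := isCompact_uIcc.exists_bound_of_continuousOn hfc
  have hnear : ∀ᶠ x in 𝓝 x₀, ∀ t ∈ uIcc a b, ContDiffAt ℝ 1 G (x, t) ∧
      ‖fderiv ℝ G (x, t)‖ < C + 1 := by
    refine isCompact_uIcc.eventually_forall_of_forall_eventually fun t ht => ?_
    exact ((hG t ht).eventually (by simp)).and
      (((hG t ht).continuousAt_fderiv one_ne_zero).norm.eventually_lt_const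
        ((hC t ht).trans_lt (lt_add_one C)))
  have hcont : ∀ᶠ x in 𝓝 x₀, ContinuousOn (fun t => G (x, t)) (uIcc a b) := by
    filter_upwards [hnear] with x hx t ht
    exact ((hx t ht).1.continuousAt.comp (f := fun t => (x, t))
      (by fun_prop)).continuousWithinAt
  refine (intervalIntegral.hasFDerivAt_integral_of_dominated_of_fderiv_le (𝕜 := ℝ)
    (F := fun x t => G (x, t)) (bound := fun _ => C + 1)
    (F' := fun x t => fderiv ℝ G (x, t) ∘L .inl ℝ X ℝ) hnear ?_
    hcont.self_of_nhds.intervalIntegrable ?_ ?_ intervalIntegrable_const ?_).differentiableAt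
  · filter_upwards [hcont] with x hx
    exact (hx.mono uIoc_subset_uIcc).aestronglyMeasurable measurableSet_uIoc
  · exact ((hfc.mono uIoc_subset_uIcc).clm_comp
      continuousOn_const).aestronglyMeasurable measurableSet_uIoc
  · refine Eventually.of_forall fun t ht x hx => ?_
    calc ‖fderiv ℝ G (x, t) ∘L .inl ℝ X ℝ‖
        ≤ ‖fderiv ℝ G (x, t)‖ * ‖ContinuousLinearMap.inl ℝ X ℝ‖ :=
          ContinuousLinearMap.opNorm_comp_le _ _
      _ ≤ ‖fderiv ℝ G (x, t)‖ :=
          mul_le_of_le_one_right (norm_nonneg _) (ContinuousLinearMap.norm_inl_le_one ℝ X ℝ)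
      _ ≤ C + 1 := (hx t (uIoc_subset_uIcc ht)).2.le
  · refine Eventually.of_forall fun t ht x hx => ?_
    exact ((hx t (uIoc_subset_uIcc ht)).1.differentiableAt one_ne_zero).hasFDerivAt.comp
      (f := fun x => (x, t)) x (hasFDerivAt_prodMk_left x t)

theorem hasDerivAt_integral_segment {f : ℂ → ℂ} {c z : ℂ} {δ : ℝ}
    (hf : DifferentiableOn ℂ f (ball c δ)) (hz : z ∈ ball c δ) :
    HasDerivAt (fun w => ∫ t in (0 : ℝ)..1, f (c + t • (w - c)) * (w - c)) (f z) z := by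
  obtain ⟨G, hG⟩ := hf.isExactOn_ball
  refine ((hG z hz).sub_const (G c)).congr_of_eventuallyEq ?_
  filter_upwards [isOpen_ball.mem_nhds hz] with w hw
  have hseg : ∀ t ∈ uIcc (0 : ℝ) 1, c + t • (w - c) ∈ ball c δ := fun t ht =>
    (convex_ball c δ).add_smul_sub_mem (mem_ball_self (pos_of_mem_ball hz)) hw
      (uIcc_of_le (zero_le_one' ℝ) ▸ ht)
  have hline : ∀ t : ℝ, HasDerivAt (fun t : ℝ => c + t • (w - c)) (w - c) t := fun t => by
    simpa using ((hasDerivAt_id t).smul_const (w - c)).const_add c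
  have hcont : ContinuousOn (fun t : ℝ => f (c + t • (w - c)) * (w - c)) (uIcc 0 1) :=
    (hf.continuousOn.comp (by fun_prop) hseg).mul continuousOn_const
  simpa using intervalIntegral.integral_eq_sub_of_hasDerivAt
    (fun t ht => (hG _ (hseg t ht)).comp t (hline t)) hcont.intervalIntegrable

theorem exists_parametric_primitive {g : X × ℂ → ℂ} {p₀ : X} {a₀ : ℂ}
    (hg : ContDiffAt ℝ 1 g (p₀, a₀))
    (hol : ∀ᶠ z : X × ℂ in 𝓝 (p₀, a₀), DifferentiableAt ℂ (fun a => g (z.1, a)) z.2) :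
    ∃ Ψ : X × ℂ → ℂ, ∀ᶠ z : X × ℂ in 𝓝 (p₀, a₀),
      DifferentiableAt ℝ Ψ z ∧ HasDerivAt (fun w => Ψ (z.1, w)) (g z) z.2 := by
  obtain ⟨δ, hδ, hball⟩ := Metric.eventually_nhds_iff_ball.1 ((hg.eventually (by simp)).and hol)
  have hmem : ∀ p ∈ ball p₀ δ, ∀ a ∈ ball a₀ δ, ContDiffAt ℝ 1 g (p, a) ∧
      DifferentiableAt ℂ (fun w => g (p, w)) a := fun p hp a ha =>
    hball (p, a) (ball_prod_same p₀ a₀ δ ▸ ⟨hp, ha⟩)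
  refine ⟨fun z => ∫ t in (0 : ℝ)..1, g (z.1, a₀ + t • (z.2 - a₀)) * (z.2 - a₀), ?_⟩
  filter_upwards [ball_mem_nhds (p₀, a₀) hδ] with z hz
  rw [← ball_prod_same] at hz
  refine ⟨differentiableAt_integral_of_contDiffAt
      (G := fun q : (X × ℂ) × ℝ => g (q.1.1, a₀ + q.2 • (q.1.2 - a₀)) * (q.1.2 - a₀))
      fun t ht => ?_,
    hasDerivAt_integral_segment
      (fun a ha => (hmem z.1 hz.1 a ha).2.differentiableWithinAt) hz.2⟩
  have hseg : a₀ + t • (z.2 - a₀) ∈ ball a₀ δ :=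
    (convex_ball a₀ δ).add_smul_sub_mem (mem_ball_self hδ) hz.2 (uIcc_of_le (zero_le_one' ℝ) ▸ ht)
  exact ((hmem z.1 hz.1 _ hseg).1.comp (z, t)
    (f := fun q : (X × ℂ) × ℝ => (q.1.1, a₀ + q.2 • (q.1.2 - a₀))) (by fun_prop)).mul
    (by fun_prop)

end ParametricPrimitive

/-! ## Local structure at a smooth point -/

section LocalStructure

variable {E : Type*} [NormedAddCommGroup E] [NormedSpace ℝ E] {Z : E → Set (ℂ × ℂ)} {p₀ : E}
  {x : ℂ × ℂ}

/-- `Φ` is a local primitive of `μ dζ` along the curves `Z p`, depending differentiably on the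
parameter `p`.  Near `(p₀, x)` its differential in `(ζ, μ)` has to be `μ dζ` only at the points of
the curves. -/
def IsPrimitiveGerm (Z : E → Set (ℂ × ℂ)) (p₀ : E) (x : ℂ × ℂ) (Φ : E × ℂ × ℂ → ℂ) : Prop :=
  ∀ᶠ q in 𝓝 (p₀, x), DifferentiableAt ℝ Φ q ∧
    (q.2 ∈ Z q.1 → HasFDerivAt (fun z => Φ (q.1, z)) (muForm q.2) q.2)

/-- The local structure of the curves `Z p` near a point `x` of `Z p₀` which is all that the
continuation of periods of `μ dζ` in `p` uses. -/
structure IsSmoothFamilyAt (Z : E → Set (ℂ × ℂ)) (p₀ : E) (x : ℂ × ℂ) : Prop where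
  exists_primitive : ∃ Φ, IsPrimitiveGerm Z p₀ x Φ
  exists_section : ∃ Y : E → ℂ × ℂ, Y p₀ = x ∧ ∀ᶠ p in 𝓝 p₀, DifferentiableAt ℝ Y p ∧ Y p ∈ Z p
  joined : ∀ O ∈ 𝓝 (p₀, x), ∀ᶠ q : E × (ℂ × ℂ) × (ℂ × ℂ) in 𝓝 (p₀, x, x),
    q.2.1 ∈ Z q.1 → q.2.2 ∈ Z q.1 → ∃ γ : ℝ → ℂ × ℂ, ContDiffOn ℝ 1 γ (Icc 0 1) ∧
      γ 0 = q.2.1 ∧ γ 1 = q.2.2 ∧ ∀ t ∈ Icc (0 : ℝ) 1, γ t ∈ Z q.1 ∧ (q.1, γ t) ∈ O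

theorem IsPrimitiveGerm.of_swap {Φ : E × ℂ × ℂ → ℂ}
    (hΦ : IsPrimitiveGerm (fun p => Prod.swap ⁻¹' Z p) p₀ x.swap Φ) :
    IsPrimitiveGerm Z p₀ x fun q => q.2.1 * q.2.2 - Φ (q.1, q.2.swap) := by
  have hswap : Tendsto (fun q : E × ℂ × ℂ => (q.1, q.2.swap)) (𝓝 (p₀, x)) (𝓝 (p₀, x.swap)) :=
    (by fun_prop : Continuous fun q : E × ℂ × ℂ => (q.1, q.2.swap)).tendsto _
  filter_upwards [hswap.eventually hΦ] with q hq
  have hsw : HasFDerivAt Prod.swap _ q.2 :=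
    (ContinuousLinearEquiv.prodComm ℂ ℂ ℂ).toContinuousLinearMap.hasFDerivAt
  refine ⟨DifferentiableAt.sub (by fun_prop) (hq.1.comp
    (f := fun q : E × ℂ × ℂ => (q.1, q.2.swap)) q ?_), fun hZ => ?_⟩
  · exact differentiableAt_fst.prodMk (differentiableAt_snd.snd.prodMk differentiableAt_snd.fst)
  · refine ((hasFDerivAt_fst.mul hasFDerivAt_snd).sub ((hq.2 hZ).comp q.2 hsw)).congr_fderiv ?_
    ext <;> simp [muForm]

theorem IsSmoothFamilyAt.of_swap
    (h : IsSmoothFamilyAt (fun p => Prod.swap ⁻¹' Z p) p₀ x.swap) : IsSmoothFamilyAt Z p₀ x where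
  exists_primitive := h.exists_primitive.imp' _ fun _ => IsPrimitiveGerm.of_swap
  exists_section := by
    obtain ⟨Y, hY₀, hY⟩ := h.exists_section
    refine ⟨fun p => (Y p).swap, by simp [hY₀], hY.mono fun p hp => ⟨?_, hp.2⟩⟩
    exact hp.1.snd.prodMk hp.1.fst
  joined O hO := by
    have hsw : Continuous fun q : E × ℂ × ℂ => (q.1, q.2.swap) := by fun_prop
    have hO' : (fun q : E × ℂ × ℂ => (q.1, q.2.swap)) ⁻¹' O ∈ 𝓝 (p₀, x.swap) :=
      hsw.tendsto (p₀, x.swap) (by simpa using hO)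
    have hsw₂ : Tendsto (fun q : E × (ℂ × ℂ) × (ℂ × ℂ) => (q.1, q.2.1.swap, q.2.2.swap))
        (𝓝 (p₀, x, x)) (𝓝 (p₀, x.swap, x.swap)) :=
      (by fun_prop : Continuous fun q : E × (ℂ × ℂ) × (ℂ × ℂ) =>
        (q.1, q.2.1.swap, q.2.2.swap)).tendsto _
    filter_upwards [hsw₂.eventually (h.joined _ hO')] with q hq h₁ h₂
    obtain ⟨γ, hγ, hγ₀, hγ₁, hγZ⟩ := hq (by simpa using h₁) (by simpa using h₂)
    exact ⟨fun t => (γ t).swap, hγ.snd.prodMk hγ.fst, by simp [hγ₀], by simp [hγ₁], hγZ⟩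

section Graph

variable {g : E × ℂ → ℂ} {a₀ : ℂ}

theorem exists_isPrimitiveGerm_of_graph (hg : ContDiffAt ℝ 1 g (p₀, a₀))
    (hol : ∀ᶠ z in 𝓝 (p₀, a₀), DifferentiableAt ℂ (fun a => g (z.1, a)) z.2)
    (hZ : ∀ᶠ q in 𝓝 (p₀, a₀, g (p₀, a₀)), q.2 ∈ Z q.1 ↔ g (q.1, q.2.1) = q.2.2) :
    ∃ Φ, IsPrimitiveGerm Z p₀ (a₀, g (p₀, a₀)) Φ := by
  obtain ⟨Ψ, hΨ⟩ := exists_parametric_primitive hg hol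
  have hproj : Tendsto (fun q : E × ℂ × ℂ => (q.1, q.2.1)) (𝓝 (p₀, a₀, g (p₀, a₀)))
      (𝓝 (p₀, a₀)) :=
    (by fun_prop : Continuous fun q : E × ℂ × ℂ => (q.1, q.2.1)).tendsto _
  refine ⟨fun q => Ψ (q.1, q.2.1), ?_⟩
  filter_upwards [hproj.eventually hΨ, hZ] with q hq hqZ
  refine ⟨hq.1.comp (f := fun q : E × ℂ × ℂ => (q.1, q.2.1)) q (by fun_prop), fun hmem => ?_⟩
  rw [muForm, ← hqZ.1 hmem]
  exact hq.2.comp_hasFDerivAt q.2 hasFDerivAt_fst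

theorem eventually_joined_of_graph (hg : ContDiffAt ℝ 1 g (p₀, a₀))
    (hZ : ∀ᶠ q in 𝓝 (p₀, a₀, g (p₀, a₀)), q.2 ∈ Z q.1 ↔ g (q.1, q.2.1) = q.2.2)
    {O : Set (E × ℂ × ℂ)} (hO : O ∈ 𝓝 (p₀, a₀, g (p₀, a₀))) :
    ∀ᶠ q : E × (ℂ × ℂ) × (ℂ × ℂ) in 𝓝 (p₀, (a₀, g (p₀, a₀)), (a₀, g (p₀, a₀))),
      q.2.1 ∈ Z q.1 → q.2.2 ∈ Z q.1 → ∃ γ : ℝ → ℂ × ℂ, ContDiffOn ℝ 1 γ (Icc 0 1) ∧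
        γ 0 = q.2.1 ∧ γ 1 = q.2.2 ∧ ∀ t ∈ Icc (0 : ℝ) 1, γ t ∈ Z q.1 ∧ (q.1, γ t) ∈ O := by
  have hcurve : ContinuousAt (fun z : E × ℂ => (z.1, z.2, g z)) (p₀, a₀) :=
    continuousAt_fst.prodMk (continuousAt_snd.prodMk hg.continuousAt)
  obtain ⟨δ, hδ, hball⟩ := Metric.eventually_nhds_iff_ball.1
    ((hg.eventually (by simp)).and ((hcurve.eventually hZ).and (hcurve.eventually_mem hO)))
  have hδZ : ∀ᶠ q in 𝓝 (p₀, a₀, g (p₀, a₀)),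
      (q.1, q.2.1) ∈ ball (p₀, a₀) δ ∧ (q.2 ∈ Z q.1 ↔ g (q.1, q.2.1) = q.2.2) :=
    (((continuous_fst.prodMk continuous_snd.fst).tendsto (p₀, a₀, g (p₀, a₀))).eventually_mem
      (ball_mem_nhds _ hδ)).and hZ
  filter_upwards [((continuous_fst.prodMk continuous_snd.fst).tendsto _).eventually hδZ,
    ((continuous_fst.prodMk continuous_snd.snd).tendsto _).eventually hδZ]
    with q ⟨hb, hq⟩ ⟨hb', hq'⟩ hy hy'
  set c : ℝ → E × ℂ := fun t => (q.1, q.2.1.1 + t • (q.2.2.1 - q.2.1.1))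
  have hc : ∀ t ∈ Icc (0 : ℝ) 1, c t ∈ ball (p₀, a₀) δ := fun t ht => by
    simpa [c] using (convex_ball (p₀, a₀) δ).add_smul_sub_mem hb hb' ht
  refine ⟨fun t => ((c t).2, g (c t)), fun t ht => ?_, ?_, ?_, fun t ht => ?_⟩
  · have hcC : ContDiffAt ℝ 1 c t := by fun_prop
    exact (hcC.snd.prodMk ((hball _ (hc t ht)).1.comp t hcC)).contDiffWithinAt
  · exact Prod.ext (by simp [c]) (by simpa [c] using hq.1 hy)
  · exact Prod.ext (by simp [c]) (by simpa [c] using hq'.1 hy')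
  · exact ⟨(hball _ (hc t ht)).2.1.2 rfl, (hball _ (hc t ht)).2.2⟩

theorem isSmoothFamilyAt_of_graph (hg : ContDiffAt ℝ 1 g (p₀, a₀))
    (hol : ∀ᶠ z in 𝓝 (p₀, a₀), DifferentiableAt ℂ (fun a => g (z.1, a)) z.2)
    (hZ : ∀ᶠ q in 𝓝 (p₀, a₀, g (p₀, a₀)), q.2 ∈ Z q.1 ↔ g (q.1, q.2.1) = q.2.2) :
    IsSmoothFamilyAt Z p₀ (a₀, g (p₀, a₀)) where
  exists_primitive := exists_isPrimitiveGerm_of_graph hg hol hZ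
  exists_section := by
    refine ⟨fun p => (a₀, g (p, a₀)), rfl, ?_⟩
    have hline : Tendsto (fun p : E => (p, a₀)) (𝓝 p₀) (𝓝 (p₀, a₀)) :=
      (Continuous.prodMk_left a₀).tendsto _
    have hgraph : Tendsto (fun p : E => (p, a₀, g (p, a₀))) (𝓝 p₀) (𝓝 (p₀, a₀, g (p₀, a₀))) :=
      tendsto_id.prodMk_nhds (tendsto_const_nhds.prodMk_nhds (hg.continuousAt.tendsto.comp hline))
    filter_upwards [hline.eventually (hg.eventually (by simp)), hgraph.eventually hZ]
      with p hp hpZ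
    refine ⟨(differentiableAt_const a₀).prodMk ?_, hpZ.2 rfl⟩
    exact (hp.differentiableAt one_ne_zero).comp (f := fun p => (p, a₀)) p (by fun_prop)
  joined _ hO := eventually_joined_of_graph hg hZ hO

end Graph

theorem isSmoothFamilyAt_of_deriv_snd_ne_zero [CompleteSpace E] {F : E → ℂ × ℂ → ℂ}
    (hF : ContDiffAt ℝ 1 (fun q : E × ℂ × ℂ => F q.1 q.2) (p₀, x))
    (hol : ∀ᶠ q in 𝓝 (p₀, x), DifferentiableAt ℂ (F q.1) q.2)
    (hZ : ∀ᶠ q in 𝓝 (p₀, x), q.2 ∈ Z q.1 ↔ F q.1 q.2 = 0) (hx : F p₀ x = 0)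
    (hne : deriv (fun b => F p₀ (x.1, b)) x.2 ≠ 0) : IsSmoothFamilyAt Z p₀ x := by
  obtain ⟨g, hg, hgol, hgF⟩ := exists_implicit_graph hF hol hx hne
  have hgx : (x.1, g (p₀, x.1)) = x := Prod.ext rfl (hgF.self_of_nhds.1 hx)
  have hgZ : ∀ᶠ q in 𝓝 (p₀, x), q.2 ∈ Z q.1 ↔ g (q.1, q.2.1) = q.2.2 := by
    filter_upwards [hZ, hgF] with q hq hq' using hq.trans hq'
  rw [← hgx]
  exact isSmoothFamilyAt_of_graph hg hgol (by rwa [hgx])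

theorem isSmoothFamilyAt_of_deriv_ne_zero [CompleteSpace E] {F : E → ℂ × ℂ → ℂ}
    (hF : ContDiffAt ℝ 1 (fun q : E × ℂ × ℂ => F q.1 q.2) (p₀, x))
    (hol : ∀ᶠ q in 𝓝 (p₀, x), DifferentiableAt ℂ (F q.1) q.2)
    (hZ : ∀ᶠ q in 𝓝 (p₀, x), q.2 ∈ Z q.1 ↔ F q.1 q.2 = 0) (hx : F p₀ x = 0)
    (hne : deriv (fun a => F p₀ (a, x.2)) x.1 ≠ 0 ∨ deriv (fun b => F p₀ (x.1, b)) x.2 ≠ 0) :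
    IsSmoothFamilyAt Z p₀ x := by
  refine hne.elim (fun hne => ?_) (isSmoothFamilyAt_of_deriv_snd_ne_zero hF hol hZ hx)
  have hswap : Tendsto (fun q : E × ℂ × ℂ => (q.1, q.2.swap)) (𝓝 (p₀, x.swap)) (𝓝 (p₀, x)) :=
    (by fun_prop : Continuous fun q : E × ℂ × ℂ => (q.1, q.2.swap)).tendsto _
  refine IsSmoothFamilyAt.of_swap (isSmoothFamilyAt_of_deriv_snd_ne_zero
    (F := fun p z => F p z.swap) ?_ ?_ (hswap.eventually hZ) hx hne)
  · exact hF.comp (p₀, x.swap) (f := fun q : E × ℂ × ℂ => (q.1, q.2.swap))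
      (contDiffAt_fst.prodMk (contDiffAt_snd.snd.prodMk contDiffAt_snd.fst))
  · filter_upwards [hswap.eventually hol] with q hq
    exact hq.comp q.2 (differentiableAt_snd.prodMk differentiableAt_fst)

theorem IsPrimitiveGerm.exists_sub_eq {Φ Φ' : E × ℂ × ℂ → ℂ} (h : IsSmoothFamilyAt Z p₀ x)
    (hΦ : IsPrimitiveGerm Z p₀ x Φ) (hΦ' : IsPrimitiveGerm Z p₀ x Φ') :
    ∃ c : E → ℂ, (∀ᶠ p in 𝓝 p₀, DifferentiableAt ℝ c p) ∧
      ∀ᶠ q in 𝓝 (p₀, x), q.2 ∈ Z q.1 → Φ q - Φ' q = c q.1 := by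
  obtain ⟨Y, hY₀, hY⟩ := h.exists_section
  have hYx : Tendsto Y (𝓝 p₀) (𝓝 x) := hY₀ ▸ hY.self_of_nhds.1.continuousAt
  have hgraph : Tendsto (fun p => (p, Y p)) (𝓝 p₀) (𝓝 (p₀, x)) := tendsto_id.prodMk_nhds hYx
  have hpair : Tendsto (fun q : E × ℂ × ℂ => (q.1, Y q.1, q.2)) (𝓝 (p₀, x)) (𝓝 (p₀, x, x)) :=
    continuousAt_fst.tendsto.prodMk_nhds
      ((hYx.comp continuousAt_fst.tendsto).prodMk_nhds continuousAt_snd)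
  refine ⟨fun p => Φ (p, Y p) - Φ' (p, Y p), ?_, ?_⟩
  · filter_upwards [hY, hgraph.eventually (hΦ.and hΦ')] with p hp hq
    have hYp : DifferentiableAt ℝ (fun p => (p, Y p)) p := differentiableAt_id.prodMk hp.1
    exact (hq.1.1.comp p hYp).sub (hq.2.1.comp p hYp)
  · filter_upwards [hpair.eventually (h.joined _ (hΦ.and hΦ')),
      continuousAt_fst.eventually hY] with q hq hYq hqZ
    obtain ⟨γ, hγ, hγ₀, hγ₁, hγZ⟩ := hq hYq.2 hqZ
    have hγ' := PiecewiseC1On.of_contDiffOn zero_le_one hγ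
    have hint₁ := hγ'.integral_snd_mul_deriv_fst (Φ := fun z => Φ (q.1, z)) le_rfl zero_le_one
      le_rfl fun t ht => (hγZ t ht).2.1.2 (hγZ t ht).1
    have hint₂ := hγ'.integral_snd_mul_deriv_fst (Φ := fun z => Φ' (q.1, z)) le_rfl zero_le_one
      le_rfl fun t ht => (hγZ t ht).2.2.2 (hγZ t ht).1
    simp only [hγ₀, hγ₁] at hint₁ hint₂
    linear_combination hint₂ - hint₁

end LocalStructure

/-! ## Continuation along a path -/

theorem unitInterval_rel_zero_one_of_local {R : I → I → Prop}
    (hloc : ∀ t, ∃ u : Set I, IsOpen u ∧ t ∈ u ∧ ∀ a ∈ u, ∀ b ∈ u, a < b → Icc a b ⊆ u → R a b)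
    (htrans : ∀ a b c, a < b → b < c → R a b → R b c → R a c) : R 0 1 := by
  choose u hu hmem hR using hloc
  obtain ⟨t, ht₀, hmono, ⟨m, hm⟩, hsub⟩ := exists_monotone_Icc_subset_open_cover_unitInterval hu
    fun s _ => mem_iUnion.2 ⟨s, hmem s⟩
  have hstep : ∀ k, t k < t (k + 1) → R (t k) (t (k + 1)) := fun k hk => by
    obtain ⟨i, hi⟩ := hsub k
    exact hR i _ (hi (left_mem_Icc.2 hk.le)) _ (hi (right_mem_Icc.2 hk.le)) hk hi
  have hrel : ∀ k, 0 < t k → R 0 (t k) := fun k => by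
    induction k with
    | zero => exact fun h => absurd ht₀ h.ne'
    | succ k ih =>
      intro hpos
      rcases (hmono k.le_succ).eq_or_lt with heq | hlt
      · exact heq ▸ ih (heq ▸ hpos)
      rcases (unitInterval.nonneg' (t := t k)).eq_or_lt with hzero | hk
      · exact hzero ▸ hstep k hlt
      · exact htrans _ _ _ hk hlt (ih hk) (hstep k hlt)
  exact hm m le_rfl ▸ hrel m (hm m le_rfl ▸ zero_lt_one)

section Continuation

variable {E : Type*} [NormedAddCommGroup E] [NormedSpace ℝ E] {Z : E → Set (ℂ × ℂ)} {p₀ : E}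
  {x : ℂ × ℂ}

theorem IsPrimitiveGerm.add_comp_fst {Φ : E × ℂ × ℂ → ℂ} (hΦ : IsPrimitiveGerm Z p₀ x Φ)
    {c : E → ℂ} (hc : ∀ᶠ p in 𝓝 p₀, DifferentiableAt ℝ c p) :
    IsPrimitiveGerm Z p₀ x fun q => Φ q + c q.1 := by
  filter_upwards [hΦ, continuousAt_fst.eventually hc] with q hq hcq
  exact ⟨hq.1.add (hcq.comp q differentiableAt_fst), fun hZ => (hq.2 hZ).add_const _⟩

/-- Continuation of primitives of `μ dζ` along the part of `ℓ₀` between the parameters `a` and `b`: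
starting from any primitive `A` at `ℓ₀ a`, there is a primitive `B` at `ℓ₀ b` such that
`∫_a^b μ dζ = B - A` on all the paths near `ℓ₀` on the curves near `Z p₀`. -/
def PrimitivesContinue (Z : E → Set (ℂ × ℂ)) (p₀ : E) (ℓ₀ : I → ℂ × ℂ) (a b : I) : Prop :=
  ∀ A, IsPrimitiveGerm Z p₀ (ℓ₀ a) A → ∃ B, IsPrimitiveGerm Z p₀ (ℓ₀ b) B ∧
    ∃ ε > 0, ∀ᶠ p in 𝓝 p₀, ∀ γ : ℝ → ℂ × ℂ, PiecewiseC1On γ 0 1 → (∀ s : I, γ s ∈ Z p) →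
      (∀ s : I, dist (γ s) (ℓ₀ s) < ε) →
      ∫ t in a..b, (γ t).2 * deriv (fun s => (γ s).1) t = B (p, γ b) - A (p, γ a)

theorem PrimitivesContinue.trans {ℓ₀ : I → ℂ × ℂ} {a b c : I}
    (hab : PrimitivesContinue Z p₀ ℓ₀ a b) (hbc : PrimitivesContinue Z p₀ ℓ₀ b c) :
    PrimitivesContinue Z p₀ ℓ₀ a c := by
  intro A hA
  obtain ⟨B, hB, ε, hε, hAB⟩ := hab A hA
  obtain ⟨C, hC, ε', hε', hBC⟩ := hbc B hB
  refine ⟨C, hC, min ε ε', lt_min hε hε', ?_⟩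
  filter_upwards [hAB, hBC] with p hp hp' γ hγ hγZ hγd
  have hint : ∀ s t : I, IntervalIntegrable (fun t => (γ t).2 * deriv (fun s => (γ s).1) t)
      volume s t := fun s t =>
    ((hγ.comp_contDiff contDiff_fst).intervalIntegrable_mul_deriv hγ.continuousOn.snd).mono_set
      (uIcc_of_le (zero_le_one' ℝ) ▸ OrdConnected.uIcc_subset ordConnected_Icc s.2 t.2)
  rw [← intervalIntegral.integral_add_adjacent_intervals (hint a b) (hint b c),
    hp γ hγ hγZ fun s => (hγd s).trans_le (min_le_left _ _),
    hp' γ hγ hγZ fun s => (hγd s).trans_le (min_le_right _ _)]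
  ring

theorem IsSmoothFamilyAt.exists_primitivesContinue {ℓ₀ : I → ℂ × ℂ} (hℓ₀ : Continuous ℓ₀)
    (hsm : ∀ s, IsSmoothFamilyAt Z p₀ (ℓ₀ s)) (s₀ : I) :
    ∃ u : Set I, IsOpen u ∧ s₀ ∈ u ∧ ∀ a ∈ u, ∀ b ∈ u, a < b → Icc a b ⊆ u →
      PrimitivesContinue Z p₀ ℓ₀ a b := by
  obtain ⟨Φ, hΦ⟩ := (hsm s₀).exists_primitive
  obtain ⟨δ, hδ, hball⟩ := Metric.eventually_nhds_iff_ball.1 hΦ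
  have hΦu : ∀ s, ℓ₀ s ∈ ball (ℓ₀ s₀) (δ / 2) → IsPrimitiveGerm Z p₀ (ℓ₀ s) Φ := fun s hs => by
    have hmem : (p₀, ℓ₀ s) ∈ ball (p₀, ℓ₀ s₀) δ := by
      rw [← ball_prod_same]
      exact ⟨mem_ball_self hδ, ball_subset_ball (half_le_self hδ.le) hs⟩
    exact eventually_of_mem (isOpen_ball.mem_nhds hmem) hball
  refine ⟨ℓ₀ ⁻¹' ball (ℓ₀ s₀) (δ / 2), isOpen_ball.preimage hℓ₀, mem_ball_self (half_pos hδ),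
    fun a ha b hb hab hsub A hA => ?_⟩
  obtain ⟨c, hc, hAΦ⟩ := hA.exists_sub_eq (hsm a) (hΦu a ha)
  obtain ⟨ε, hε, hAε⟩ := Metric.eventually_nhds_iff_ball.1 hAΦ
  refine ⟨fun q => Φ q + c q.1, (hΦu b hb).add_comp_fst hc, min ε (δ / 2),
    lt_min hε (half_pos hδ), ?_⟩
  filter_upwards [ball_mem_nhds p₀ hε, ball_mem_nhds p₀ hδ] with p hpε hpδ γ hγ hγZ hγd
  have hγΦ : ∀ t ∈ Icc (a : ℝ) b, HasFDerivAt (fun z => Φ (p, z)) (muForm (γ t)) (γ t) := by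
    intro t ht
    lift t to I using ⟨a.2.1.trans ht.1, ht.2.trans b.2.2⟩
    refine (hball (p, γ t) ?_).2 (hγZ t)
    rw [← ball_prod_same]
    refine ⟨hpδ, mem_ball.2 ?_⟩
    linarith [dist_triangle (γ t) (ℓ₀ t) (ℓ₀ s₀), (hγd t).trans_le (min_le_right _ _),
      mem_ball.1 (hsub ht)]
  have hAa : A (p, γ a) - Φ (p, γ a) = c p :=
    hAε (p, γ a) (ball_prod_same p₀ (ℓ₀ a) ε ▸ ⟨hpε, (hγd a).trans_le (min_le_left _ _)⟩) (hγZ a)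
  rw [hγ.integral_snd_mul_deriv_fst a.2.1 (Subtype.coe_le_coe.2 hab.le) b.2.2 hγΦ]
  linear_combination hAa

/-- `ℓ` is a piecewise smooth closed path in the set `C`. -/
def IsClosedPathIn (C : Set (ℂ × ℂ)) {x : ℂ × ℂ} (ℓ : Path x x) : Prop :=
  IsPiecewiseC1 ℓ ∧ ∀ s, ℓ s ∈ C

theorem exists_period_function {x₀ : ℂ × ℂ} (ℓ₀ : Path x₀ x₀)
    (hsm : ∀ s, IsSmoothFamilyAt Z p₀ (ℓ₀ s)) :
    ∃ ε > 0, ∃ J : E → ℂ, ∀ᶠ p in 𝓝 p₀, DifferentiableAt ℝ J p ∧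
      ∀ (x : ℂ × ℂ) (ℓ : Path x x), IsClosedPathIn (Z p) ℓ →
        (∀ s, dist (ℓ s) (ℓ₀ s) < ε) → curveIntegral muForm ℓ = J p := by
  have hcont : PrimitivesContinue Z p₀ ℓ₀ 0 1 := unitInterval_rel_zero_one_of_local
    (IsSmoothFamilyAt.exists_primitivesContinue ℓ₀.continuous hsm) fun _ _ _ _ _ => .trans
  obtain ⟨A, hA⟩ := (hsm 0).exists_primitive
  obtain ⟨B, hB, ε, hε, hAB⟩ := hcont A hA
  rw [ℓ₀.source] at hA
  rw [ℓ₀.target] at hB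
  obtain ⟨J, hJ, hBA⟩ := hB.exists_sub_eq (ℓ₀.source ▸ hsm 0) hA
  obtain ⟨δ, hδ, hball⟩ := Metric.eventually_nhds_iff_ball.1 hBA
  refine ⟨min ε δ, lt_min hε hδ, J, ?_⟩
  filter_upwards [hJ, hAB, ball_mem_nhds p₀ hδ] with p hJp hp hpδ
  refine ⟨hJp, fun x ℓ ⟨hℓ, hℓZ⟩ hℓd => ?_⟩
  have hx : x ∈ ball x₀ δ := by simpa using (hℓd 0).trans_le (min_le_right _ _)
  have hint := hp ℓ.extend hℓ (by simpa using hℓZ)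
    (by simpa using fun s => (hℓd s).trans_le (min_le_left _ _))
  rw [curveIntegral_muForm hℓ]
  simp only [Icc.coe_zero, Icc.coe_one, Path.extend_zero, Path.extend_one] at hint
  exact hint.trans (hball (p, x) (ball_prod_same p₀ x₀ δ ▸ ⟨hpδ, hx⟩) (by simpa using hℓZ 0))

/-- Pairs of points near `ℓ₀ a` and `ℓ₀ b` on a common curve near `Z p₀` are joined on that curve by
a path which is uniformly `η`-close to the part of `ℓ₀` between the parameters `a` and `b`. -/
def PathsLift (Z : E → Set (ℂ × ℂ)) (p₀ : E) (ℓ₀ : I → ℂ × ℂ) (η : ℝ) (a b : I) : Prop :=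
  ∀ᶠ q : E × (ℂ × ℂ) × (ℂ × ℂ) in 𝓝 (p₀, ℓ₀ a, ℓ₀ b), q.2.1 ∈ Z q.1 → q.2.2 ∈ Z q.1 →
    ∃ γ : ℝ → ℂ × ℂ, PiecewiseC1On γ a b ∧ γ a = q.2.1 ∧ γ b = q.2.2 ∧
      ∀ s ∈ Icc a b, γ s ∈ Z q.1 ∧ dist (γ s) (ℓ₀ s) < η

theorem PathsLift.trans {ℓ₀ : I → ℂ × ℂ} {η : ℝ} {a b c : I}
    (hsm : IsSmoothFamilyAt Z p₀ (ℓ₀ b)) (hab : PathsLift Z p₀ ℓ₀ η a b)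
    (hbc : PathsLift Z p₀ ℓ₀ η b c) : PathsLift Z p₀ ℓ₀ η a c := by
  obtain ⟨Y, hY₀, hY⟩ := hsm.exists_section
  have hYb : Tendsto (fun q : E × (ℂ × ℂ) × (ℂ × ℂ) => Y q.1) (𝓝 (p₀, ℓ₀ a, ℓ₀ c)) (𝓝 (ℓ₀ b)) :=
    Tendsto.comp (hY₀ ▸ hY.self_of_nhds.1.continuousAt) continuousAt_fst.tendsto
  have hleft := continuousAt_fst.tendsto.prodMk_nhds
    ((continuousAt_snd.fst (x := (p₀, ℓ₀ a, ℓ₀ c))).tendsto.prodMk_nhds hYb)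
  have hright := continuousAt_fst.tendsto.prodMk_nhds
    (hYb.prodMk_nhds (continuousAt_snd.snd (x := (p₀, ℓ₀ a, ℓ₀ c))).tendsto)
  filter_upwards [hleft.eventually hab, hright.eventually hbc, continuousAt_fst.eventually hY]
    with q hq hq' hYq hqa hqc
  obtain ⟨γ, hγ, hγa, hγb, hγZ⟩ := hq hqa hYq.2
  obtain ⟨γ', hγ', hγ'b, hγ'c, hγ'Z⟩ := hq' hYq.2 hqc
  set β : ℝ → ℂ × ℂ := fun t => if t ≤ b then γ t else γ' t
  have hβ : EqOn β γ (Iic b) := fun t ht => if_pos ht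
  have hβ' : EqOn β γ' (Ici b) := fun t ht => by
    rcases (mem_Ici.1 ht).eq_or_lt with rfl | ht
    · simp [β, hγb, hγ'b]
    · exact if_neg (not_le.2 ht)
  refine ⟨β, (hγ.congr (hβ.mono Icc_subset_Iic_self)).trans
    (hγ'.congr (hβ'.mono Icc_subset_Ici_self)), (hβ hγ.le).trans hγa, (hβ' hγ'.le).trans hγ'c,
    fun s hs => ?_⟩
  rcases le_total s b with hsb | hbs
  · exact hβ (Subtype.coe_le_coe.2 hsb) ▸ hγZ s ⟨hs.1, hsb⟩
  · exact hβ' (Subtype.coe_le_coe.2 hbs) ▸ hγ'Z s ⟨hbs, hs.2⟩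

theorem IsSmoothFamilyAt.exists_pathsLift {ℓ₀ : I → ℂ × ℂ} (hℓ₀ : Continuous ℓ₀) {s₀ : I}
    (hsm : IsSmoothFamilyAt Z p₀ (ℓ₀ s₀)) {η : ℝ} (hη : 0 < η) :
    ∃ u : Set I, IsOpen u ∧ s₀ ∈ u ∧ ∀ a ∈ u, ∀ b ∈ u, a < b → Icc a b ⊆ u →
      PathsLift Z p₀ ℓ₀ η a b := by
  have hO : ∀ᶠ q : E × ℂ × ℂ in 𝓝 (p₀, ℓ₀ s₀), dist q.2 (ℓ₀ s₀) < η / 2 :=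
    continuousAt_snd.eventually (ball_mem_nhds _ (half_pos hη))
  obtain ⟨δ, hδ, hball⟩ := Metric.eventually_nhds_iff_ball.1 (hsm.joined _ hO)
  refine ⟨ℓ₀ ⁻¹' ball (ℓ₀ s₀) (min δ (η / 2)), isOpen_ball.preimage hℓ₀,
    mem_ball_self (lt_min hδ (half_pos hη)), fun a ha b hb hab hsub => ?_⟩
  have hab' : (p₀, ℓ₀ a, ℓ₀ b) ∈ ball (p₀, ℓ₀ s₀, ℓ₀ s₀) δ := by
    simp only [← ball_prod_same]
    exact ⟨mem_ball_self hδ, ball_subset_ball (min_le_left _ _) ha,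
      ball_subset_ball (min_le_left _ _) hb⟩
  filter_upwards [isOpen_ball.mem_nhds hab'] with q hq hqa hqb
  obtain ⟨γ, hγ, hγ₀, hγ₁, hγZ⟩ := hball q hq hqa hqb
  have hba : (0 : ℝ) < b - a := sub_pos.2 hab
  have hmaps : MapsTo (fun t : ℝ => (t - a) / (b - a)) (Icc a b) (Icc 0 1) := fun t ht =>
    ⟨div_nonneg (sub_nonneg.2 ht.1) hba.le, div_le_one_of_le₀ (by linarith [ht.2]) hba.le⟩
  refine ⟨fun t => γ ((t - a) / (b - a)), .of_contDiffOn (Subtype.coe_le_coe.2 hab.le)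
    (hγ.comp (by fun_prop) hmaps), by simp [hγ₀], by simp [hγ₁, hba.ne'], fun s hs => ?_⟩
  obtain ⟨hZ, hd⟩ := hγZ _ (hmaps hs)
  have hs₀ : dist (ℓ₀ s) (ℓ₀ s₀) < η / 2 := (hsub hs).trans_le (min_le_right _ _)
  exact ⟨hZ, (dist_triangle_right _ _ (ℓ₀ s₀)).trans_lt (by linarith [mem_ball.1 hd])⟩

theorem eventually_exists_closedPath_near {x₀ : ℂ × ℂ} (ℓ₀ : Path x₀ x₀)
    (hsm : ∀ s, IsSmoothFamilyAt Z p₀ (ℓ₀ s)) {η : ℝ} (hη : 0 < η) :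
    ∀ᶠ p in 𝓝 p₀, ∃ (x : ℂ × ℂ) (ℓ : Path x x), IsClosedPathIn (Z p) ℓ ∧
      ∀ s, dist (ℓ s) (ℓ₀ s) < η := by
  have hlift : PathsLift Z p₀ ℓ₀ η 0 1 := unitInterval_rel_zero_one_of_local
    (fun s => (hsm s).exists_pathsLift ℓ₀.continuous hη) fun _ b _ _ _ => .trans (hsm b)
  obtain ⟨Y, hY₀, hY⟩ := (hsm 0).exists_section
  have hYx : Tendsto Y (𝓝 p₀) (𝓝 x₀) := by
    simpa [ContinuousAt, hY₀] using hY.self_of_nhds.1.continuousAt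
  have hdiag : Tendsto (fun p => (p, Y p, Y p)) (𝓝 p₀) (𝓝 (p₀, ℓ₀ 0, ℓ₀ 1)) := by
    simpa using tendsto_id.prodMk_nhds (hYx.prodMk_nhds hYx)
  filter_upwards [hY, hdiag.eventually hlift] with p hp hl
  obtain ⟨γ, hγ, hγ₀, hγ₁, hγZ⟩ := hl hp.2 hp.2
  let ℓ : Path (Y p) (Y p) :=
    { toFun := fun s => γ s
      continuous_toFun := hγ.continuousOn.comp_continuous continuous_subtype_val Subtype.prop
      source' := hγ₀
      target' := hγ₁ }
  refine ⟨Y p, ℓ, ⟨hγ.congr fun t ht => ℓ.extend_apply ht, fun s => (hγZ s ?_).1⟩,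
    fun s => (hγZ s ?_).2⟩ <;> exact ⟨s.2.1, s.2.2⟩

end Continuation

/-! ## Families of zero loci -/

/-- A closed path `ℓ p` in `Z p` for each parameter value `p ∈ W`, jointly continuous in `p` and
the parameter of the path. -/
def IsClosedPathFamilyIn {P : Type*} [TopologicalSpace P] (Z : P → Set (ℂ × ℂ)) (W : Set P)
    {x : P → ℂ × ℂ} (ℓ : ∀ p, Path (x p) (x p)) : Prop :=
  (∀ p ∈ W, IsClosedPathIn (Z p) (ℓ p)) ∧
    ContinuousOn (fun q : P × I => ℓ q.1 q.2) (W ×ˢ univ)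

namespace IsClosedPathFamilyIn

variable {P : Type*} [TopologicalSpace P] {Z : P → Set (ℂ × ℂ)} {W : Set P} {x : P → ℂ × ℂ}
  {ℓ : ∀ p, Path (x p) (x p)} {p : P}

theorem eventually_dist_lt (hℓ : IsClosedPathFamilyIn Z W ℓ) (hp : p ∈ W) {ε : ℝ} (hε : 0 < ε) :
    ∀ᶠ p' in 𝓝[W] p, ∀ s, dist (ℓ p' s) (ℓ p s) < ε := by
  obtain ⟨v, hv, hvε⟩ := isCompact_univ.mem_uniformity_of_prod
    (f := fun (p : P) (s : I) => ℓ p s) hℓ.2 hp (dist_mem_uniformity hε)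
  filter_upwards [hv] with p' hp' s
  exact hvε p' hp' s (mem_univ s)

theorem continuousWithinAt_periodJ_of_projLength_le (hℓ : IsClosedPathFamilyIn Z W ℓ) (hp : p ∈ W)
    {M : ℝ} (hM : ∀ᶠ p' in 𝓝[W] p, projLength (ℓ p') ≤ M) :
    ContinuousWithinAt (fun p' => periodJ (ℓ p')) W p := by
  set C := max M 0 + ∫ t in (0 : ℝ)..1, ‖deriv (fun s => ((ℓ p).extend s).2) t‖
  have hC : 0 ≤ C := add_nonneg (le_max_right _ _)
    (intervalIntegral.integral_nonneg zero_le_one fun _ _ => norm_nonneg _)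
  refine Metric.tendsto_nhds.2 fun e he => ?_
  filter_upwards [hℓ.eventually_dist_lt hp (ε := e / (C + 1)) (by positivity), hM,
    self_mem_nhdsWithin] with p' hdist hlen hp'
  rw [Real.dist_eq]
  calc |periodJ (ℓ p') - periodJ (ℓ p)|
      ≤ e / (C + 1) * (projLength (ℓ p') + ∫ t in (0 : ℝ)..1,
          ‖deriv (fun s => ((ℓ p).extend s).2) t‖) :=
        abs_periodJ_sub_le (hℓ.1 p hp).1 (hℓ.1 p' hp').1 fun s => (hdist s).le
    _ ≤ e / (C + 1) * C := by
        gcongr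
        exact add_le_add (hlen.trans (le_max_left _ _)) le_rfl
    _ < e / (C + 1) * (C + 1) := by gcongr; exact lt_add_one C
    _ = e := div_mul_cancel₀ _ (by positivity)

end IsClosedPathFamilyIn

section HolomorphicFamily

variable {E : Type*} {F : E → ℂ × ℂ → ℂ} {G : Set E} {Ω : E → Set (ℂ × ℂ)}

/-- The plane curve `F p = 0` in the domain `Ω p`. -/
def zeroLocus (F : E → ℂ × ℂ → ℂ) (Ω : E → Set (ℂ × ℂ)) (p : E) : Set (ℂ × ℂ) :=
  {x | x ∈ Ω p ∧ F p x = 0}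

/-- The singular points of the plane curve `zeroLocus F Ω p`, where both partial derivatives of
its equation vanish. -/
def singularLocus (F : E → ℂ × ℂ → ℂ) (Ω : E → Set (ℂ × ℂ)) (p : E) : Set (ℂ × ℂ) :=
  {x | x ∈ zeroLocus F Ω p ∧ deriv (fun a => F p (a, x.2)) x.1 = 0 ∧
    deriv (fun b => F p (x.1, b)) x.2 = 0}

variable [NormedAddCommGroup E] [NormedSpace ℝ E]

/-- The functions `F p`, for `p ∈ G`, are holomorphic on `Ω p` and continuously differentiable in
all the variables, including the parameter.  Openness is asked of the total domain only: `G` is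
then automatically a neighbourhood of each `p ∈ G` with `Ω p` nonempty. -/
structure IsHolomorphicFamilyOn (F : E → ℂ × ℂ → ℂ) (G : Set E) (Ω : E → Set (ℂ × ℂ)) :
    Prop where
  isOpen_total : IsOpen {q : E × ℂ × ℂ | q.1 ∈ G ∧ q.2 ∈ Ω q.1}
  contDiffOn : ContDiffOn ℝ 1 (fun q : E × ℂ × ℂ => F q.1 q.2) {q | q.1 ∈ G ∧ q.2 ∈ Ω q.1}
  differentiableAt : ∀ p ∈ G, ∀ x ∈ Ω p, DifferentiableAt ℂ (F p) x

namespace IsHolomorphicFamilyOn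

theorem eventually_mem (hF : IsHolomorphicFamilyOn F G Ω) {p₀ : E} (hp₀ : p₀ ∈ G) {x : ℂ × ℂ}
    (hx : x ∈ Ω p₀) : ∀ᶠ p in 𝓝 p₀, p ∈ G := by
  have hline : Tendsto (fun p : E => (p, x)) (𝓝 p₀) (𝓝 (p₀, x)) :=
    (Continuous.prodMk_left x).tendsto p₀
  filter_upwards [hline.eventually_mem (hF.isOpen_total.mem_nhds ⟨hp₀, hx⟩)] with p hp using hp.1

variable [CompleteSpace E]

theorem isSmoothFamilyAt (hF : IsHolomorphicFamilyOn F G Ω) {p₀ : E} (hp₀ : p₀ ∈ G) {x : ℂ × ℂ}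
    (hx : x ∈ zeroLocus F Ω p₀) (hns : x ∉ singularLocus F Ω p₀) :
    IsSmoothFamilyAt (zeroLocus F Ω) p₀ x := by
  have htot : ∀ᶠ q : E × ℂ × ℂ in 𝓝 (p₀, x), q.1 ∈ G ∧ q.2 ∈ Ω q.1 :=
    hF.isOpen_total.mem_nhds ⟨hp₀, hx.1⟩
  exact isSmoothFamilyAt_of_deriv_ne_zero (hF.contDiffOn.contDiffAt htot)
    (htot.mono fun q hq => hF.differentiableAt q.1 hq.1 q.2 hq.2)
    (htot.mono fun q hq => and_iff_right hq.2) hx.2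
    (not_and_or.1 fun h => hns ⟨hx, h⟩)

theorem exists_periodJ_eq (hF : IsHolomorphicFamilyOn F G Ω) {p₀ : E} (hp₀ : p₀ ∈ G)
    {x₀ : ℂ × ℂ} {ℓ₀ : Path x₀ x₀} (hℓ₀ : IsClosedPathIn (zeroLocus F Ω p₀) ℓ₀)
    (hns : ∀ s, ℓ₀ s ∉ singularLocus F Ω p₀) :
    ∃ ε > 0, ∃ J : E → ℝ, ∀ᶠ p in 𝓝 p₀, DifferentiableAt ℝ J p ∧
      ∀ (x : ℂ × ℂ) (ℓ : Path x x), IsClosedPathIn (zeroLocus F Ω p) ℓ →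
        (∀ s, dist (ℓ s) (ℓ₀ s) < ε) → periodJ ℓ = J p := by
  obtain ⟨ε, hε, J, hJ⟩ := exists_period_function ℓ₀
    fun s => hF.isSmoothFamilyAt hp₀ (hℓ₀.2 s) (hns s)
  refine ⟨ε, hε, fun p => (J p).re, hJ.mono fun p hp =>
    ⟨Complex.reCLM.differentiableAt.comp p hp.1, fun x ℓ hℓ hd => ?_⟩⟩
  exact congrArg Complex.re (hp.2 x ℓ hℓ hd)

theorem differentiableWithinAt_periodJ (hF : IsHolomorphicFamilyOn F G Ω) {W : Set E}
    (hW : W ⊆ G) {x : E → ℂ × ℂ} {ℓ : ∀ p, Path (x p) (x p)}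
    (hℓ : IsClosedPathFamilyIn (zeroLocus F Ω) W ℓ) {p : E} (hp : p ∈ W)
    (hns : ∀ s, ℓ p s ∉ singularLocus F Ω p) :
    DifferentiableWithinAt ℝ (fun p' => periodJ (ℓ p')) W p := by
  obtain ⟨ε, hε, J, hJ⟩ := hF.exists_periodJ_eq (hW hp) (hℓ.1 p hp) hns
  refine hJ.self_of_nhds.1.differentiableWithinAt.congr_of_eventuallyEq_of_mem ?_ hp
  filter_upwards [hℓ.eventually_dist_lt hp hε, nhdsWithin_le_nhds hJ, self_mem_nhdsWithin]
    with p' hd hJp' hp'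
  exact hJp'.2 _ _ (hℓ.1 p' hp') hd

theorem continuousOn_periodJ (hF : IsHolomorphicFamilyOn F G Ω) {W : Set E}
    (hW : W ⊆ G) {x : E → ℂ × ℂ} {ℓ : ∀ p, Path (x p) (x p)}
    (hℓ : IsClosedPathFamilyIn (zeroLocus F Ω) W ℓ)
    (hlen : ∀ p ∈ W, (∃ s, ℓ p s ∈ singularLocus F Ω p) →
      ∃ M : ℝ, ∀ᶠ p' in 𝓝[W] p, projLength (ℓ p') ≤ M) :
    ContinuousOn (fun p => periodJ (ℓ p)) W := fun p hp => by
  by_cases hs : ∃ s, ℓ p s ∈ singularLocus F Ω p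
  · obtain ⟨M, hM⟩ := hlen p hp hs
    exact hℓ.continuousWithinAt_periodJ_of_projLength_le hp hM
  · exact (hF.differentiableWithinAt_periodJ hW hℓ hp (not_exists.1 hs)).continuousWithinAt

theorem exists_differentiableOn_periodJ (hF : IsHolomorphicFamilyOn F G Ω) {p₀ : E}
    (hp₀ : p₀ ∈ G) {x₀ : ℂ × ℂ} {ℓ₀ : Path x₀ x₀} (hℓ₀ : IsClosedPathIn (zeroLocus F Ω p₀) ℓ₀)
    (hns : ∀ s, ℓ₀ s ∉ singularLocus F Ω p₀) {ε₀ : ℝ} (hε₀ : 0 < ε₀) :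
    ∃ ε > 0, ε < ε₀ ∧ ∃ V ⊆ G, IsOpen V ∧ p₀ ∈ V ∧
      ∃ J : E → ℝ, DifferentiableOn ℝ J V ∧ ∀ p ∈ V,
        (∃ (x : ℂ × ℂ) (ℓ : Path x x), IsClosedPathIn (zeroLocus F Ω p) ℓ ∧
          ∀ s, dist (ℓ s) (ℓ₀ s) < ε) ∧
        (∀ (x : ℂ × ℂ) (ℓ : Path x x), IsClosedPathIn (zeroLocus F Ω p) ℓ →
          (∀ s, dist (ℓ s) (ℓ₀ s) < ε) → periodJ ℓ = J p) := by
  obtain ⟨ε₁, hε₁, J, hJ⟩ := hF.exists_periodJ_eq hp₀ hℓ₀ hns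
  have hε : 0 < min ε₁ (ε₀ / 2) := lt_min hε₁ (half_pos hε₀)
  have hnear := eventually_exists_closedPath_near ℓ₀
    (fun s => hF.isSmoothFamilyAt hp₀ (hℓ₀.2 s) (hns s)) hε
  obtain ⟨V, hV, hVo, hpV⟩ := _root_.eventually_nhds_iff.1
    ((hF.eventually_mem hp₀ (hℓ₀.2 0).1).and (hJ.and hnear))
  refine ⟨min ε₁ (ε₀ / 2), hε, (min_le_right _ _).trans_lt (half_lt_self hε₀), V,
    fun p hp => (hV p hp).1, hVo, hpV, J,
    fun p hp => (hV p hp).2.1.1.differentiableWithinAt,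
    fun p hp => ⟨(hV p hp).2.2, fun x ℓ hℓ hd => ?_⟩⟩
  exact (hV p hp).2.1.2 x ℓ hℓ fun s => (hd s).trans_le (min_le_left _ _)

end IsHolomorphicFamilyOn

theorem mainTheorem5_general [CompleteSpace E] (hF : IsHolomorphicFamilyOn F G Ω) :
    (∀ W ⊆ G, ∀ (x : E → ℂ × ℂ) (ℓ : ∀ p, Path (x p) (x p)),
      IsClosedPathFamilyIn (zeroLocus F Ω) W ℓ →
      (∀ p ∈ W, (∃ s, ℓ p s ∈ singularLocus F Ω p) →
        ∃ M : ℝ, ∀ᶠ p' in 𝓝[W] p, projLength (ℓ p') ≤ M) →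
      ContinuousOn (fun p => periodJ (ℓ p)) W) ∧
    (∀ W ⊆ G, ∀ (x : E → ℂ × ℂ) (ℓ : ∀ p, Path (x p) (x p)),
      IsClosedPathFamilyIn (zeroLocus F Ω) W ℓ →
      ∀ p ∈ W, (∀ s, ℓ p s ∉ singularLocus F Ω p) →
        DifferentiableWithinAt ℝ (fun p' => periodJ (ℓ p')) W p) ∧
    (∀ p₀ ∈ G, ∀ (x₀ : ℂ × ℂ) (ℓ₀ : Path x₀ x₀), IsClosedPathIn (zeroLocus F Ω p₀) ℓ₀ →
      (∀ s, ℓ₀ s ∉ singularLocus F Ω p₀) →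
      ∀ ε₀ > 0, ∃ ε > 0, ε < ε₀ ∧ ∃ V ⊆ G, IsOpen V ∧ p₀ ∈ V ∧
        ∃ J : E → ℝ, DifferentiableOn ℝ J V ∧ ∀ p ∈ V,
          (∃ (x : ℂ × ℂ) (ℓ : Path x x), IsClosedPathIn (zeroLocus F Ω p) ℓ ∧
            ∀ s, dist (ℓ s) (ℓ₀ s) < ε) ∧
          (∀ (x : ℂ × ℂ) (ℓ : Path x x), IsClosedPathIn (zeroLocus F Ω p) ℓ →
            (∀ s, dist (ℓ s) (ℓ₀ s) < ε) → periodJ ℓ = J p)) :=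
  ⟨fun _ hW _ _ => hF.continuousOn_periodJ hW,
    fun _ hW _ _ hℓ _ => hF.differentiableWithinAt_periodJ hW hℓ,
    fun _ hp₀ _ _ hℓ₀ hns _ => hF.exists_differentiableOn_periodJ hp₀ hℓ₀ hns⟩

end HolomorphicFamily

/-! ## The spectral family -/

theorem differentiableAt_det {V ι : Type*} [NormedAddCommGroup V] [NormedSpace ℂ V] [Fintype ι]
    [DecidableEq ι] {M : V → Matrix ι ι ℂ} {x : V}
    (hM : ∀ i j, DifferentiableAt ℂ (fun v => M v i j) x) :
    DifferentiableAt ℂ (fun v => (M v).det) x := by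
  simp only [Matrix.det_apply]
  exact DifferentiableAt.fun_sum fun e _ => DifferentiableAt.const_smul
    (HasFDerivAt.finsetProd fun _ _ => (hM _ _).hasFDerivAt).differentiableAt _

namespace SpectralData

variable {N n : ℕ} {r : Option (Fin n) → ℕ} {T D : Type*} {S : SpectralData N n r T D}

theorem differentiableAt_F (S : SpectralData N n r T D) (p : T × D) {x : ℂ × ℂ}
    (hx : ∀ ν, x.1 ≠ S.b ν p) : DifferentiableAt ℂ (fun x : ℂ × ℂ => S.F p x.1 x.2) x := by
  refine differentiableAt_det fun i j => ?_
  simp only [coeffMatrix, Matrix.sub_apply, Matrix.smul_apply, Matrix.sum_apply, smul_eq_mul]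
  refine ((DifferentiableAt.fun_sum fun ν _ => DifferentiableAt.fun_sum fun k _ => ?_).fun_sub
    (by fun_prop)).fun_sub (by fun_prop)
  have h : DifferentiableAt ℂ (fun x : ℂ × ℂ => (x.1 - S.b ν p) ^ (k + 1)) x := by fun_prop
  exact (h.fun_inv (pow_ne_zero _ (sub_ne_zero.2 (hx ν)))).mul_const _

theorem forall_notMem_singularPoints {p : T × D} (hp : p ∈ S.dom) {x : ℂ × ℂ}
    {ℓ : Path x x} (h : p ∉ S.discrSet ∨ ∀ s, ℓ s ∉ S.singularPoints p) :
    ∀ s, ℓ s ∉ S.singularPoints p :=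
  h.elim (fun h _ hs => h ⟨hp, _, hs⟩) id

namespace IsParameterization

variable [NormedAddCommGroup T] [NormedSpace ℝ T] [NormedAddCommGroup D] [NormedSpace ℝ D]

theorem isOpen_dom_diff_fixedSing (hS : S.IsParameterization) : IsOpen (S.dom \ S.fixedSing) := by
  refine isOpen_iff_mem_nhds.2 fun p hp => ?_
  have hdom := hS.isOpen_dom.mem_nhds hp.1
  have hb : ∀ ν, ContinuousAt (S.b ν) p := fun ν => (hS.continuousOn_b ν).continuousAt hdom
  have ht : ∀ ν i, ContinuousAt (S.t ν (r ν) i) p := fun ν i =>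
    (hS.continuousOn_t ν _ i le_rfl).continuousAt hdom
  have h := hp.2
  simp only [fixedSing, mem_ofPred_eq, not_or, not_exists, not_and] at h
  obtain ⟨h1, h2, h3⟩ := h
  have e1 : ∀ᶠ p' in 𝓝 p, ∀ ν ρ, ν ≠ ρ → S.b ν p' ≠ S.b ρ p' := by
    simp only [Filter.eventually_all]
    exact fun ν ρ hne => (ContinuousAt.ne_iff_eventually_ne (hb ν) (hb ρ)).1 (h1 ν ρ hne)
  have e2 : ∀ᶠ p' in 𝓝 p, ∀ ν i j, i ≠ j → S.t ν (r ν) i p' ≠ S.t ν (r ν) j p' := by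
    simp only [Filter.eventually_all]
    exact fun ν i j hne => (ContinuousAt.ne_iff_eventually_ne (ht ν i) (ht ν j)).1 (h2 ν i j hne)
  have e3 : ∀ᶠ p' in 𝓝 p, ∀ ν k, S.t ν (r ν) k p' ≠ 0 := by
    simp only [Filter.eventually_all]
    exact fun ν k => (ht ν k).eventually_ne (h3 ν k)
  filter_upwards [hdom, e1, e2, e3] with p' h0 h1 h2 h3
  refine ⟨h0, ?_⟩
  simp only [fixedSing, mem_ofPred_eq, not_or, not_exists, not_and]
  exact ⟨h1, h2, h3⟩

theorem isOpen_setOf_forall_ne_b (hS : S.IsParameterization) :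
    IsOpen {q : (T × D) × ℂ × ℂ | q.1 ∈ S.dom \ S.fixedSing ∧ ∀ ν, q.2.1 ≠ S.b ν q.1} := by
  refine isOpen_iff_mem_nhds.2 fun q hq => ?_
  have hb : ∀ ν, ContinuousAt (fun q : (T × D) × ℂ × ℂ => S.b ν q.1) q := fun ν =>
    ContinuousAt.comp (g := S.b ν)
      ((hS.continuousOn_b ν).continuousAt (hS.isOpen_dom.mem_nhds hq.1.1)) continuousAt_fst
  have e : ∀ᶠ q' in 𝓝 q, ∀ ν, q'.2.1 ≠ S.b ν q'.1 := by
    simp only [Filter.eventually_all]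
    have hζ : ContinuousAt (fun q : (T × D) × ℂ × ℂ => q.2.1) q := by fun_prop
    exact fun ν => (ContinuousAt.ne_iff_eventually_ne hζ (hb ν)).1 (hq.2 ν)
  filter_upwards [continuousAt_fst.eventually (hS.isOpen_dom_diff_fixedSing.mem_nhds hq.1), e]
    with q' h1 h2
  exact ⟨h1, h2⟩

theorem isHolomorphicFamilyOn (hS : S.IsParameterization) :
    IsHolomorphicFamilyOn (fun p x => S.F p x.1 x.2) (S.dom \ S.fixedSing)
      (fun p => {x | ∀ ν, x.1 ≠ S.b ν p}) where
  isOpen_total := hS.isOpen_setOf_forall_ne_b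
  contDiffOn := hS.contDiffOn_F
  differentiableAt p _ _ hx := S.differentiableAt_F p hx

end IsParameterization

end SpectralData

end

theorem mainTheorem5 {N n : ℕ} {r : Option (Fin n) → ℕ} {T D : Type*}
    [NormedAddCommGroup T] [NormedSpace ℝ T] [FiniteDimensional ℝ T]
    [NormedAddCommGroup D] [NormedSpace ℝ D] [FiniteDimensional ℝ D]
    (S : SpectralData N n r T D) (hS : S.IsParameterization) :
    -- continuity outside the fixed singularities, at the points of the discriminant set included;
    -- only where `ℓ` runs into a singular point of the curve (which needs `p ∈ S.discrSet`) is it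
    -- required that the contours do not become infinitely long
    (∀ W ⊆ S.dom \ S.fixedSing, ∀ (x : T × D → ℂ × ℂ) (ℓ : ∀ p, Path (x p) (x p)),
      S.IsClosedPathFamily W ℓ →
      (∀ p ∈ W, (∃ s, ℓ p s ∈ S.singularPoints p) →
        ∃ M : ℝ, ∀ᶠ p' in 𝓝[W] p, projLength (ℓ p') ≤ M) →
      ContinuousOn (fun p => periodJ (ℓ p)) W) ∧
    -- differentiability outside the discriminant set
    (∀ W ⊆ S.dom \ S.fixedSing, ∀ (x : T × D → ℂ × ℂ) (ℓ : ∀ p, Path (x p) (x p)),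
      S.IsClosedPathFamily W ℓ →
      ∀ p ∈ W, (p ∉ S.discrSet ∨ ∀ s, ℓ p s ∉ S.singularPoints p) →
        DifferentiableWithinAt ℝ (fun p' => periodJ (ℓ p')) W p) ∧
    -- a single closed path continues to the nearby curves, and its period is then a well-defined
    -- differentiable function of the parameters
    (∀ p₀ ∈ S.dom \ S.fixedSing, ∀ (x₀ : ℂ × ℂ) (ℓ₀ : Path x₀ x₀), S.IsClosedPathOn p₀ ℓ₀ →
      (p₀ ∉ S.discrSet ∨ ∀ s, ℓ₀ s ∉ S.singularPoints p₀) →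
      ∀ ε₀ > 0, ∃ ε > 0, ε < ε₀ ∧ ∃ V ⊆ S.dom \ S.fixedSing, IsOpen V ∧ p₀ ∈ V ∧
        ∃ J : T × D → ℝ, DifferentiableOn ℝ J V ∧ ∀ p ∈ V,
          (∃ (x : ℂ × ℂ) (ℓ : Path x x), S.IsClosedPathOn p ℓ ∧ ∀ s, dist (ℓ s) (ℓ₀ s) < ε) ∧
          (∀ (x : ℂ × ℂ) (ℓ : Path x x), S.IsClosedPathOn p ℓ →
            (∀ s, dist (ℓ s) (ℓ₀ s) < ε) → periodJ ℓ = J p)) := by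
  have : CompleteSpace (T × D) := FiniteDimensional.complete ℝ _
  obtain ⟨hcont, hdiff, hpath⟩ := mainTheorem5_general hS.isHolomorphicFamilyOn
  exact ⟨hcont, fun W hW x ℓ hℓ p hp h => hdiff W hW x ℓ hℓ p hp
      (SpectralData.forall_notMem_singularPoints (hW hp).1 h),
    fun p₀ hp₀ x₀ ℓ₀ hℓ₀ h => hpath p₀ hp₀ x₀ ℓ₀ hℓ₀
      (SpectralData.forall_notMem_singularPoints hp₀.1 h)⟩
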